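/- Let $d\ge 2$ be an integer, let $\log$ be the natural logarithm and $0\log 0:=0$. For $0\le x,y\le 1$ put $H_2(x):=-x\log x-(1-x)\log(1-x)$ and $D_2(x\|y):=x\log\frac{x}{y}+(1-x)\log\frac{1-x}{1-y}\in[0,\infty]$, where $0\log\frac{0}{y}:=0$ for all $y\geq0$ and $x\log\frac{x}{0}:=\infty$ for $x>0$. For $\Delta\in\mathbb R$ define $$M(\Delta,d):=\min\Big\{D_2(s\|r)\ :\ 0\le s,r\le\tfrac{d-1}{d},\ H_2(s)-H_2(r)+(s-r)\log(d-1)=\Delta\Big\}\in[0,\infty],$$ with the convention $\min\emptyset:=\infty$, and $$N(d):=\max_{0<r<1/2}\ r(1-r)\Big(\log\Big(\tfrac{1-r}{r}(d-1)\Big)\Big)^2 .$$ The minimum is attained for every $\Delta\in[-\log d,\log d]$, and the maximum is attained. Moreover: 1. As a function of $\Delta\in[-\log d,\log d]$ with values in $[0,\infty]$, $M(\Delta,d)$ is non-negative, continuous and strictly convex (i.e. $M(ax+by,d)<a\,M(x,d)+b\,M(y,d)$ for $x\ne y$ in $[-\log d,\log d]$ and $a,b>0$ with $a+b=1$), and it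 is continuously differentiable on $(-\log d,\log d)$. It takes the values $M(0,d)=0$, $M(-\log d,d)=\log d$, $M(\log d,d)=\infty$, and $M(\Delta,d)<\infty$ for $\Delta\in[-\log d,\log d)$. 2. For every real $N\ge N(d)$ and every $\Delta\in\mathbb R$, $$M(\Delta,d)\ \ge\ N\Big(e^{\Delta/N}-1-\frac{\Delta}{N}\Big)\ \ge\ \frac{\Delta^2}{2N}+\frac{\Delta^3}{6N^2},$$ and for every $\Delta\in\mathbb R$, $M(\Delta,d)\ge\dfrac{\Delta^2}{3(\log d)^2}$. 3. $N(d)<\frac14(\log(d-1))^2+1$ and $N(d)<(\log d)^2$, so that $N=\frac14(\log(d-1))^2+1$ and $N=(\log d)^2$ are admissible choices in 2. -/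

import Mathlib

/-- The summand `x log (x / y)` of a relative entropy, for `0 ≤ x, y`, with values in the extended
reals: it is `0` for `x = 0` (also when `y = 0`), and `+∞` for `x > 0`, `y = 0`. -/
noncomputable def relEntropyTerm (x y : ℝ) : EReal :=
  if x = 0 then 0 else if y = 0 then ⊤ else ((x * Real.log (x / y) : ℝ) : EReal)

/-- The relative entropy `x log (x / y) + (1 - x) log ((1 - x) / (1 - y))` of the binary probability
distributions `(x, 1 - x)` and `(y, 1 - y)`, for `0 ≤ x, y ≤ 1`. -/
noncomputable def binRelEntropy (x y : ℝ) : EReal :=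
  relEntropyTerm x y + relEntropyTerm (1 - x) (1 - y)

/-- The pairs `(s, r)` with `0 ≤ s, r ≤ (d - 1) / d` and
`H(s) - H(r) + (s - r) log (d - 1) = Δ`, where `H` is the binary entropy. -/
def feasiblePairs (Δ : ℝ) (d : ℕ) : Set (ℝ × ℝ) :=
  {p | p.1 ∈ Set.Icc (0 : ℝ) (((d : ℝ) - 1) / d) ∧ p.2 ∈ Set.Icc (0 : ℝ) (((d : ℝ) - 1) / d) ∧
    Real.binEntropy p.1 - Real.binEntropy p.2 + (p.1 - p.2) * Real.log ((d : ℝ) - 1) = Δ}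

/-- `M(Δ, d)`: the minimum of the binary relative entropy over the feasible pairs. It is an infimum
in the extended reals, so it is `+∞` if no pair is feasible. -/
noncomputable def boundM (Δ : ℝ) (d : ℕ) : EReal :=
  sInf ((fun p : ℝ × ℝ => binRelEntropy p.1 p.2) '' feasiblePairs Δ d)

/-- The function `r (1 - r) (log ((1 - r) / r * (d - 1))) ^ 2`. -/
noncomputable def varSurprisal (d : ℕ) (r : ℝ) : ℝ :=
  r * (1 - r) * Real.log ((1 - r) / r * ((d : ℝ) - 1)) ^ 2

/-- `N(d)`: the maximum of `varSurprisal d` over `0 < r < 1 / 2`. -/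
noncomputable def boundN (d : ℕ) : ℝ :=
  sSup (varSurprisal d '' Set.Ioo (0 : ℝ) (1 / 2))

/-!
For `b = d - 1` put `H(s) = H₂(s) + s log b` (`entropy b`) and parametrize `r` by the tilting
parameter `t = H'(r) ≥ 0`, so that `r = b / (b + e ^ t)` (`prob b t`). With the log-partition
function `Z(t) = log (1 + b e ^ (-t))`, which satisfies `Z' = -r` and `Z'' = r (1 - r)`, the
relative entropy is `D₂(s‖r) = Z(t) + t s - H(s)` (`gibbsDiv b s t`).

*Convexity.* The main point is that for every multiplier `l ≠ 0` the Lagrangian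
`D₂(s‖r) - l (H(s) - H(r))` has at most one minimizer (`lagrangian_minimizer_unique`); for `l = 0`
the minimizers are the pairs `s = r`, which all have entropy difference `0`.
If `l ≤ -1`, then `s = 0` is optimal, and the critical point equation is `t (1 - r) = -1 / l`, with
a strictly increasing left-hand side. If `l > -1`, then `s = prob b (t / (1 + l))` is optimal, by
Gibbs' inequality, and a function of `t` alone remains. At each of its critical points `t > 0`, the
inequality `log x < x - 1` gives `t (1 - r) > 1`, and there the second derivative is a positive multiple of
`(t r + 1) (t (1 - r) - 1)`. So all critical points are strict local minima and there is at most
one.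

Hence `M(Δ, d) - l Δ` has a unique minimizer in `Δ` for every `l`. Since `M` is lower
semicontinuous, balancing the minima of `M - l Δ` to the left and to the right of a given interior
point yields a multiplier for which this point is the minimizer (`exists_strict_subgradient`). This
is strict convexity. Varying only `r` near an optimal pair bounds `M` from above by a
differentiable function that touches it, so the multiplier is the derivative
(`hasDerivAt_minRelEntropy`); a strictly increasing derivative is continuous by Darboux's theorem.

*Lower bounds.* `varSurprisal d r` equals `t ^ 2 Z''(t)`. If this is at most `N`, integrating twice
along `a ↦ a t` bounds the minimum of the Lagrangian for `l = 1 / a - 1` from below by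
`-N ((1 + l) log (1 + l) - l)` (`gibbsDiv_tilt_le`). For `l = e ^ (Δ / N) - 1` this is the asserted
bound (`bound_le_minRelEntropy`).

*The constant `N(d)`.* With `v = (t - log b) / 2` one has
`t ^ 2 Z''(t) = (log b + 2 v) ^ 2 / (4 cosh ^ 2 v)`, and the estimates follow from the
Cauchy–Schwarz inequality and `1 + v ^ 2 < cosh ^ 2 v` (`tiltVariance_lt`). The case `d = 2` needs the
numerical bound `N(2) ≤ 0.45` (`tiltVariance_one_le`).
-/

open Set Filter Topology

namespace EntropyDifference

variable {b : ℝ}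

/-! ### The one-parameter family of tilted distributions -/

/-- The probability `b / (b + e ^ t)` of leaving the ground state in the Gibbs distribution with one
level of energy `0` and `b` levels of energy `1`, at inverse temperature `t`. For `b = d - 1`, this
parametrizes `(0, 1)` so that `t` is the derivative of `entropy b` at `prob b t`; the interval
`(0, (d - 1) / d]` corresponds to `t ≥ 0`. -/
noncomputable def prob (b t : ℝ) : ℝ := b / (b + Real.exp t)

/-- The logarithm of the partition function `1 + b e ^ (-t)`. -/
noncomputable def logPartition (b t : ℝ) : ℝ := Real.log (1 + b * Real.exp (-t))

/-- The function `H₂(s) + s log b`: the entropy of a distribution on `b + 1` points which gives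
mass `1 - s` to one of them and divides `s` equally among the others. -/
noncomputable def entropy (b s : ℝ) : ℝ := Real.binEntropy s + s * Real.log b

/-- The relative entropy of `s` and `prob b t`, as a real number (see
`binRelEntropy_prob`). This is the form `Z(t) + t s - H(s)`, in which `s` and `t` interact only
through a product. -/
noncomputable def gibbsDiv (b s t : ℝ) : ℝ := logPartition b t + t * s - entropy b s

lemma prob_pos (hb : 0 < b) (t : ℝ) : 0 < prob b t := by unfold prob; positivity

lemma prob_lt_one (hb : 0 < b) (t : ℝ) : prob b t < 1 := by
  unfold prob
  rw [div_lt_one (by positivity)]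
  linarith [Real.exp_pos t]

lemma one_sub_prob (hb : 0 < b) (t : ℝ) : 1 - prob b t = Real.exp t / (b + Real.exp t) := by
  unfold prob
  have : 0 < b + Real.exp t := by positivity
  field_simp
  ring

lemma prob_zero (b : ℝ) : prob b 0 = b / (b + 1) := by simp [prob]

lemma logPartition_zero (b : ℝ) : logPartition b 0 = Real.log (1 + b) := by simp [logPartition]

lemma logPartition_pos (hb : 0 < b) (t : ℝ) : 0 < logPartition b t :=
  Real.log_pos (by have := Real.exp_pos (-t); nlinarith [mul_pos hb this])

lemma prob_strictAnti (hb : 0 < b) : StrictAnti (prob b) := fun x y h => by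
  unfold prob
  have := Real.exp_lt_exp.2 h
  gcongr

lemma log_one_sub_prob (hb : 0 < b) (t : ℝ) : Real.log (1 - prob b t) = -logPartition b t := by
  rw [one_sub_prob hb, logPartition, ← Real.log_inv, Real.exp_neg]
  congr 1
  have := Real.exp_pos t
  field_simp
  ring

lemma log_prob (hb : 0 < b) (t : ℝ) :
    Real.log (prob b t) = Real.log b - t - logPartition b t := by
  have h : prob b t = b * Real.exp (-t) * (1 - prob b t) := by
    rw [one_sub_prob hb, prob, Real.exp_neg]
    have := Real.exp_pos t
    field_simp
  rw [h, Real.log_mul (by positivity) (by linarith [prob_lt_one hb t]),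
    Real.log_mul hb.ne' (Real.exp_pos _).ne', Real.log_exp, log_one_sub_prob hb]
  ring

/-- The tilting parameter of `r`. -/
lemma prob_log (hb : 0 < b) {r : ℝ} (h0 : 0 < r) (h1 : r < 1) :
    prob b (Real.log ((1 - r) / r * b)) = r := by
  have : 0 < 1 - r := by linarith
  rw [prob, Real.exp_log (by positivity)]
  field_simp
  ring

lemma exists_prob_eq (hb : 0 < b) {r : ℝ} (h0 : 0 < r) (h1 : r ≤ b / (b + 1)) :
    ∃ t, 0 ≤ t ∧ prob b t = r := by
  have h2 : b / (b + 1) < 1 := (div_lt_one (by linarith)).2 (by linarith)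
  refine ⟨_, ?_, prob_log hb h0 (h1.trans_lt h2)⟩
  rw [← (prob_strictAnti hb).le_iff_ge, prob_log hb h0 (h1.trans_lt h2), prob_zero]
  exact h1

lemma hasDerivAt_prob (hb : 0 < b) (t : ℝ) :
    HasDerivAt (prob b) (-(prob b t * (1 - prob b t))) t := by
  have h := ((Real.hasDerivAt_exp t).const_add b).inv (by positivity) |>.const_mul b
  refine h.congr_deriv ?_
  rw [one_sub_prob hb, prob]
  have : 0 < b + Real.exp t := by positivity
  field_simp

lemma continuous_prob (hb : 0 < b) : Continuous (prob b) :=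
  continuous_iff_continuousAt.2 fun t => (hasDerivAt_prob hb t).continuousAt

lemma hasDerivAt_logPartition (hb : 0 < b) (t : ℝ) :
    HasDerivAt (logPartition b) (-prob b t) t := by
  have h0 : HasDerivAt (fun t => Real.exp (-t)) (Real.exp (-t) * (-1)) t :=
    (hasDerivAt_neg t).exp
  have h := ((h0.const_mul b).const_add 1).log (by positivity)
  refine h.congr_deriv ?_
  rw [prob, Real.exp_neg]
  have := Real.exp_pos t
  field_simp
  ring

lemma entropy_prob (hb : 0 < b) (t : ℝ) :
    entropy b (prob b t) = logPartition b t + t * prob b t := by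
  rw [entropy, Real.binEntropy_eq_negMulLog_add_negMulLog_one_sub, Real.negMulLog, Real.negMulLog,
    log_prob hb, log_one_sub_prob hb]
  ring

lemma continuous_entropy (b : ℝ) : Continuous (entropy b) := by
  unfold entropy
  fun_prop

lemma entropy_zero (b : ℝ) : entropy b 0 = 0 := by simp [entropy]

lemma entropy_pos (hb : 1 ≤ b) {s : ℝ} (h0 : 0 < s) (h1 : s < 1) : 0 < entropy b s := by
  have := Real.binEntropy_pos h0 h1
  have := mul_nonneg h0.le (Real.log_nonneg hb)
  unfold entropy
  linarith

/-! ### The relative entropy in the tilting parameter -/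

lemma mul_log_div_gt {x y : ℝ} (hx : 0 ≤ x) (hy : 0 < y) (h : x ≠ y) :
    x - y < x * Real.log (x / y) := by
  rcases hx.eq_or_lt with rfl | hx
  · simpa using hy
  have h1 := Real.log_lt_sub_one_of_pos (x := y / x) (by positivity)
    (fun h2 => h (by field_simp at h2; exact h2.symm))
  rw [← inv_div, Real.log_inv]
  have h2 := mul_lt_mul_of_pos_left h1 hx
  have h3 : x * (y / x - 1) = y - x := by field_simp
  linarith

lemma gibbsDiv_eq (hb : 0 < b) {s : ℝ} (t : ℝ) (h0 : 0 ≤ s) (h1 : s ≤ 1) :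
    gibbsDiv b s t = s * Real.log (s / prob b t)
      + (1 - s) * Real.log ((1 - s) / (1 - prob b t)) := by
  have hp := prob_pos hb t
  have hp' := prob_lt_one hb t
  have e1 : s * Real.log (s / prob b t) = s * Real.log s - s * Real.log (prob b t) := by
    rcases h0.eq_or_lt with rfl | h0
    · simp
    · rw [Real.log_div h0.ne' hp.ne']; ring
  have e2 : (1 - s) * Real.log ((1 - s) / (1 - prob b t))
      = (1 - s) * Real.log (1 - s) - (1 - s) * Real.log (1 - prob b t) := by
    rcases h1.eq_or_lt with rfl | h1
    · simp
    · rw [Real.log_div (by linarith) (by linarith)]; ring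
  rw [e1, e2, log_prob hb, log_one_sub_prob hb, gibbsDiv, entropy,
    Real.binEntropy_eq_negMulLog_add_negMulLog_one_sub, Real.negMulLog, Real.negMulLog]
  ring

lemma gibbsDiv_self (hb : 0 < b) (t : ℝ) : gibbsDiv b (prob b t) t = 0 := by
  rw [gibbsDiv, entropy_prob hb]; ring

/-- Gibbs' inequality, strict case. -/
lemma gibbsDiv_pos (hb : 0 < b) {s t : ℝ} (h0 : 0 ≤ s) (h1 : s ≤ 1) (h : s ≠ prob b t) :
    0 < gibbsDiv b s t := by
  rw [gibbsDiv_eq hb t h0 h1]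
  have := mul_log_div_gt h0 (prob_pos hb t) h
  have := mul_log_div_gt (x := 1 - s) (y := 1 - prob b t) (by linarith)
    (by linarith [prob_lt_one hb t]) (fun h' => h (by linarith))
  linarith

lemma gibbsDiv_nonneg (hb : 0 < b) {s : ℝ} (t : ℝ) (h0 : 0 ≤ s) (h1 : s ≤ 1) :
    0 ≤ gibbsDiv b s t := by
  by_cases h : s = prob b t
  · rw [h, gibbsDiv_self hb]
  · exact (gibbsDiv_pos hb h0 h1 h).le

lemma hasDerivAt_gibbsDiv (hb : 0 < b) (s t : ℝ) :
    HasDerivAt (gibbsDiv b s) (s - prob b t) t := by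
  have := ((hasDerivAt_logPartition hb t).add ((hasDerivAt_id t).mul_const s)).sub_const
    (entropy b s)
  exact this.congr_deriv (by ring)

lemma hasDerivAt_entropy_prob (hb : 0 < b) (t : ℝ) :
    HasDerivAt (fun t => entropy b (prob b t)) (-(t * (prob b t * (1 - prob b t)))) t := by
  have h : (fun t => entropy b (prob b t)) = fun t => logPartition b t + t * prob b t :=
    funext (entropy_prob hb)
  rw [h]
  have := (hasDerivAt_logPartition hb t).add ((hasDerivAt_id t).mul (hasDerivAt_prob hb t))
  exact this.congr_deriv (by simp only [id]; ring)

/-- The maximum of the entropy is `log (b + 1)`, attained only at `s = b / (b + 1)`. -/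
lemma entropy_lt (hb : 0 < b) {s : ℝ} (h0 : 0 ≤ s) (h1 : s ≤ 1) (h : s ≠ b / (b + 1)) :
    entropy b s < Real.log (b + 1) := by
  have := gibbsDiv_pos hb h0 h1 (t := 0) (by rwa [prob_zero])
  rw [gibbsDiv, logPartition_zero, add_comm 1 b] at this
  linarith

lemma entropy_uniform (hb : 0 < b) : entropy b (b / (b + 1)) = Real.log (b + 1) := by
  rw [← prob_zero, entropy_prob hb, logPartition_zero, add_comm 1 b]; ring

lemma entropy_le (hb : 0 < b) {s : ℝ} (h0 : 0 ≤ s) (h1 : s ≤ 1) :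
    entropy b s ≤ Real.log (b + 1) := by
  by_cases h : s = b / (b + 1)
  · rw [h, entropy_uniform hb]
  · exact (entropy_lt hb h0 h1 h).le

lemma entropy_nonneg (hb : 1 ≤ b) {s : ℝ} (h0 : 0 ≤ s) (h1 : s < 1) : 0 ≤ entropy b s := by
  rcases h0.eq_or_lt with rfl | h0
  · rw [entropy_zero]
  · exact (entropy_pos hb h0 h1).le

/-! ### Minimizers of the Lagrangian -/

/-- The Lagrangian `D₂(s‖r) - l (H(s) - H(r))` for `r = prob b t`, where `H = entropy b`. -/
noncomputable def lagrangian (b l s t : ℝ) : ℝ :=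
  gibbsDiv b s t - l * (entropy b s - entropy b (prob b t))

/-- For a multiplier `l > -1`, the minimum over `s` of the Lagrangian, as a function of `t`; it is
attained at `s = prob b (t / (1 + l))`. -/
noncomputable def reducedLagrangian (b l t : ℝ) : ℝ :=
  -((1 + l) * gibbsDiv b (prob b t) (t / (1 + l)))

/-- The derivative of `reducedLagrangian b l`. -/
noncomputable def reducedSlope (b l t : ℝ) : ℝ :=
  prob b (t / (1 + l)) - prob b t - l * (t * (prob b t * (1 - prob b t)))

lemma lagrangian_eq_reduced (hb : 0 < b) {l : ℝ} (hl : -1 < l) (s t : ℝ) :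
    lagrangian b l s t = (1 + l) * gibbsDiv b s (t / (1 + l)) + reducedLagrangian b l t := by
  have : (1 + l) ≠ 0 := by linarith
  simp only [lagrangian, reducedLagrangian, gibbsDiv, entropy_prob hb]
  field_simp
  ring

lemma reducedLagrangian_neg (hb : 0 < b) {l t : ℝ} (hl : -1 < l) (hl0 : l ≠ 0) (ht : 0 < t) :
    reducedLagrangian b l t < 0 := by
  have h : t ≠ t / (1 + l) := fun h => hl0 (by
    have : (1 + l) ≠ 0 := by linarith
    field_simp at h
    linarith)
  have := gibbsDiv_pos hb (prob_pos hb t).le (prob_lt_one hb t).le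
    (fun h' => h ((prob_strictAnti hb).injective h'))
  have := mul_pos (by linarith : 0 < 1 + l) this
  unfold reducedLagrangian
  linarith

lemma hasDerivAt_reducedLagrangian (hb : 0 < b) {l : ℝ} (hl : -1 < l) (t : ℝ) :
    HasDerivAt (reducedLagrangian b l) (reducedSlope b l t) t := by
  have hk : (1 + l) ≠ 0 := by linarith
  have e : reducedLagrangian b l = fun t =>
      (1 + l) * (logPartition b t - logPartition b (t / (1 + l))) + l * (t * prob b t) := by
    funext t
    simp only [reducedLagrangian, gibbsDiv, entropy_prob hb]
    field_simp
    ring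
  rw [e]
  have h1 : HasDerivAt (fun t => logPartition b (t / (1 + l)))
      (-prob b (t / (1 + l)) * (1 / (1 + l))) t :=
    (hasDerivAt_logPartition hb _).comp t ((hasDerivAt_id t).div_const (1 + l))
  have := (((hasDerivAt_logPartition hb t).sub h1).const_mul (1 + l)).add
    (((hasDerivAt_id t).mul (hasDerivAt_prob hb t)).const_mul l)
  refine this.congr_deriv ?_
  simp only [reducedSlope, id]
  field_simp
  ring

lemma hasDerivAt_reducedSlope (hb : 0 < b) (l t : ℝ) :
    HasDerivAt (reducedSlope b l)
      (-(prob b (t / (1 + l)) * (1 - prob b (t / (1 + l)))) / (1 + l)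
        + prob b t * (1 - prob b t) * (1 - l + l * t * (1 - 2 * prob b t))) t := by
  have h1 : HasDerivAt (fun t => prob b (t / (1 + l)))
      (-(prob b (t / (1 + l)) * (1 - prob b (t / (1 + l)))) * (1 / (1 + l))) t :=
    (hasDerivAt_prob hb _).comp t ((hasDerivAt_id t).div_const (1 + l))
  have hp := hasDerivAt_prob hb t
  have := (h1.sub hp).sub
    (((hasDerivAt_id t).mul (hp.mul (hp.const_sub 1))).const_mul l)
  refine this.congr_deriv ?_
  simp only [id, Pi.mul_apply]
  ring

/-- A critical point of the reduced Lagrangian lies in the region `t (1 - prob b t) > 1`. This is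
the inequality `log x < x - 1` for the ratio `x` of the odds of `prob b t` and
`prob b (t / (1 + l))`. -/
lemma one_lt_of_reducedSlope_eq_zero (hb : 0 < b) {l t : ℝ} (hl : -1 < l) (hl0 : l ≠ 0)
    (ht : 0 < t) (h : reducedSlope b l t = 0) : 1 < t * (1 - prob b t) := by
  have hk : 0 < 1 + l := by linarith
  set s := prob b (t / (1 + l)) with hs
  set r := prob b t with hr
  have hs0 : 0 < s := prob_pos hb _
  have hs1 : 0 < 1 - s := by linarith [prob_lt_one hb (t / (1 + l))]
  have hr0 : 0 < r := prob_pos hb _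
  have hr1 : 0 < 1 - r := by linarith [prob_lt_one hb t]
  have hB : s - r = l * (t * (r * (1 - r))) := by
    unfold reducedSlope at h
    linarith
  have hne : r * (1 - s) / (s * (1 - r)) ≠ 1 := by
    intro h1
    field_simp at h1
    have : s - r = 0 := by linarith
    rw [hB] at this
    have h2 : t * (r * (1 - r)) ≠ 0 := by positivity
    exact (mul_ne_zero hl0 h2) this
  have hlog := Real.log_lt_sub_one_of_pos (x := r * (1 - s) / (s * (1 - r))) (by positivity) hne
  rw [Real.log_div (by positivity) (by positivity), Real.log_mul (by positivity) (by positivity),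
    Real.log_mul (by positivity) (by positivity), hr, hs, log_prob hb, log_prob hb,
    log_one_sub_prob hb, log_one_sub_prob hb, ← hr, ← hs] at hlog
  have h1 : t / (1 + l) - t < r * (1 - s) / (s * (1 - r)) - 1 := by linarith
  have h2 : t / (1 + l) - t = -(l * t) / (1 + l) := by field_simp; ring
  have h3 : r * (1 - s) / (s * (1 - r)) - 1 = -(l * t * r) / s := by
    field_simp
    linear_combination -hB
  rw [h2, h3, div_lt_div_iff₀ hk hs0] at h1
  have h4 : 0 < l ^ 2 * t * r * (t * (1 - r) - 1) := by
    have : l ^ 2 * t * r * (t * (1 - r) - 1) = l * t * (s - r * (1 + l)) := by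
      linear_combination (-l * t) * hB
    nlinarith
  have h5 : 0 < l ^ 2 * t * r := by positivity
  have := (pos_iff_pos_of_mul_pos h4).1 h5
  linarith

lemma reducedSlope_deriv_pos (hb : 0 < b) {l t : ℝ} (hl : -1 < l) (hl0 : l ≠ 0)
    (ht : 0 < t) (h : reducedSlope b l t = 0) :
    0 < -(prob b (t / (1 + l)) * (1 - prob b (t / (1 + l)))) / (1 + l)
        + prob b t * (1 - prob b t) * (1 - l + l * t * (1 - 2 * prob b t)) := by
  have hk : 0 < 1 + l := by linarith
  have hc := one_lt_of_reducedSlope_eq_zero hb hl hl0 ht h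
  unfold reducedSlope at h
  have hr0 : 0 < prob b t := prob_pos hb _
  have hr1 : 0 < 1 - prob b t := by linarith [prob_lt_one hb t]
  set s := prob b (t / (1 + l))
  set r := prob b t
  have hs : s = r + l * (t * (r * (1 - r))) := by linarith
  -- At a critical point the derivative factors.
  have e : -(s * (1 - s)) / (1 + l) + r * (1 - r) * (1 - l + l * t * (1 - 2 * r))
      = r * (1 - r) * l ^ 2 * ((t * r + 1) * (t * (1 - r) - 1)) / (1 + l) := by
    rw [hs]
    field_simp
    ring
  rw [e]
  have : 0 < t * (1 - r) - 1 := by linarith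
  positivity

/-- A function all of whose critical points are nondegenerate local minima has at most one
minimizer. -/
lemma eq_of_isMinOn_of_deriv_pos {f f' f'' : ℝ → ℝ} (hf : ∀ t, 0 < t → HasDerivAt f (f' t) t)
    (hf' : ∀ t, 0 < t → HasDerivAt f' (f'' t) t) (hpos : ∀ t, 0 < t → f' t = 0 → 0 < f'' t)
    {x y : ℝ} (hx : 0 < x) (hy : 0 < y) (hxm : IsMinOn f (Ioi 0) x) (hym : IsMinOn f (Ioi 0) y) :
    x = y := by
  wlog hxy : x < y generalizing x y
  · rcases lt_trichotomy x y with h | h | h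
    · exact this hx hy hxm hym h
    · exact h
    · exact (this hy hx hym hxm h).symm
  exfalso
  have hcont : ContinuousOn f (Icc x y) := fun t ht =>
    (hf t (hx.trans_le ht.1)).continuousAt.continuousWithinAt
  obtain ⟨z, hz, hzm⟩ := isCompact_Icc.exists_isMaxOn (nonempty_Icc.2 hxy.le) hcont
  have hfxy : f x = f y := le_antisymm (hxm hy) (hym hx)
  obtain ⟨w, hw, hwm⟩ : ∃ w ∈ Ioo x y, ∀ t ∈ Icc x y, f t ≤ f w := by
    by_cases hz' : z ∈ Ioo x y
    · exact ⟨z, hz', fun t ht => hzm ht⟩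
    · have hzx : f z = f x := by
        have : z = x ∨ z = y := by
          by_contra! hne
          exact hz' ⟨lt_of_le_of_ne hz.1 hne.1.symm, lt_of_le_of_ne hz.2 hne.2⟩
        rcases this with h | h <;> rw [h]
        exact hfxy.symm
      refine ⟨(x + y) / 2, ⟨by linarith, by linarith⟩, fun t ht => ?_⟩
      have h1 : f t ≤ f z := hzm ht
      have h2 : f x ≤ f ((x + y) / 2) := hxm (by simp only [mem_Ioi]; linarith)
      linarith
  have hw0 : 0 < w := hx.trans hw.1
  have hmax : IsLocalMax f w := by
    filter_upwards [Icc_mem_nhds hw.1 hw.2] with t ht using hwm t ht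
  have h0 : f' w = 0 := hmax.hasDerivAt_eq_zero (hf w hw0)
  -- The derivative is positive to the right of `w`, so `f` increases there.
  have hev : ∀ᶠ t in 𝓝[>] w, 0 < f' t := by
    have := (hasDerivAt_iff_tendsto_slope.1 (hf' w hw0)).eventually (lt_mem_nhds (hpos w hw0 h0))
    filter_upwards [this.filter_mono (nhdsWithin_mono w (fun t (ht : w < t) => ht.ne')),
      self_mem_nhdsWithin] with t ht htw
    rw [slope_def_field, h0, sub_zero] at ht
    exact (div_pos_iff_of_pos_right (sub_pos.2 htw)).1 ht
  obtain ⟨u, hu, huf⟩ := (mem_nhdsGT_iff_exists_Ioo_subset' hw.2).1 hev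
  have hu' : w < u := hu
  set v := min ((w + u) / 2) y
  have hv1 : w < v := lt_min (by linarith) hw.2
  have hv2 : v < u := (min_le_left _ _).trans_lt (by linarith)
  have hmono : StrictMonoOn f (Icc w v) := by
    refine strictMonoOn_of_deriv_pos (convex_Icc _ _) (fun t ht =>
      (hf t (hw0.trans_le ht.1)).continuousAt.continuousWithinAt) fun t ht => ?_
    rw [interior_Icc] at ht
    rw [(hf t (hw0.trans ht.1)).deriv]
    exact huf ⟨ht.1, ht.2.trans hv2⟩
  have := hmono (left_mem_Icc.2 hv1.le) (right_mem_Icc.2 hv1.le) hv1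
  linarith [hwm v ⟨(hw.1.trans hv1).le, min_le_right _ _⟩]

/-- The pairs `(s, t)` with `0 ≤ s ≤ b / (b + 1)` and `t ≥ 0`, the domain of the Lagrangian. It
corresponds to the admissible pairs `(s, r)` with `r > 0`, by `r = prob b t`. -/
def domain (b : ℝ) : Set (ℝ × ℝ) := Icc 0 (b / (b + 1)) ×ˢ Ici 0

lemma prob_mem (hb : 0 < b) {t : ℝ} (ht : 0 ≤ t) : prob b t ∈ Icc 0 (b / (b + 1)) :=
  ⟨(prob_pos hb t).le, by rw [← prob_zero]; exact (prob_strictAnti hb).antitone ht⟩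

lemma uniform_lt_one (hb : 0 < b) : b / (b + 1) < 1 := (div_lt_one (by linarith)).2 (by linarith)

lemma hasDerivAt_lagrangian_zero (hb : 0 < b) (l t : ℝ) :
    HasDerivAt (lagrangian b l 0) (-(prob b t * (1 + l * (t * (1 - prob b t))))) t := by
  have := (hasDerivAt_gibbsDiv hb 0 t).sub
    (((hasDerivAt_entropy_prob hb t).const_sub (entropy b 0)).const_mul l)
  exact this.congr_deriv (by ring)

lemma exists_lagrangian_neg (hb : 0 < b) {l : ℝ} (hl0 : l ≠ 0) :
    ∃ p ∈ domain b, lagrangian b l p.1 p.2 < 0 := by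
  rcases lt_or_ge (-1) l with hl | hl
  · have hk : 0 < 1 + l := by linarith
    refine ⟨(prob b (1 / (1 + l)), 1), ⟨prob_mem hb (by positivity), zero_le_one' ℝ⟩, ?_⟩
    have := reducedLagrangian_neg hb hl hl0 one_pos
    simp only [lagrangian_eq_reduced hb hl, gibbsDiv_self hb]
    linarith
  · refine ⟨(0, 1), ⟨⟨le_rfl, by positivity⟩, zero_le_one' ℝ⟩, ?_⟩
    simp only [lagrangian, gibbsDiv, entropy_zero, entropy_prob hb]
    have := logPartition_pos hb 1
    have := prob_pos hb 1
    nlinarith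

/-- A minimizer of the Lagrangian for `l > -1`, `l ≠ 0`. -/
lemma minimizer_of_neg_one_lt (hb : 0 < b) {l : ℝ} (hl : -1 < l) (hl0 : l ≠ 0) {s t : ℝ}
    (hst : (s, t) ∈ domain b)
    (hmin : ∀ p ∈ domain b, lagrangian b l s t ≤ lagrangian b l p.1 p.2) :
    0 < t ∧ s = prob b (t / (1 + l)) ∧ IsMinOn (reducedLagrangian b l) (Ioi 0) t := by
  have hk : 0 < 1 + l := by linarith
  obtain ⟨⟨hs0, hs1⟩, ht0⟩ := hst
  simp only [mem_Ici] at ht0 hs0 hs1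
  have hs1' := hs1.trans (uniform_lt_one hb).le
  have hle : ∀ u, 0 ≤ u → lagrangian b l s t ≤ reducedLagrangian b l u := fun u hu => by
    have := hmin (prob b (u / (1 + l)), u) ⟨prob_mem hb (by positivity), hu⟩
    simpa only [lagrangian_eq_reduced hb hl (prob b (u / (1 + l))), gibbsDiv_self hb, mul_zero,
      zero_add] using this
  have hge : reducedLagrangian b l t ≤ lagrangian b l s t := by
    rw [lagrangian_eq_reduced hb hl]
    linarith [mul_nonneg hk.le (gibbsDiv_nonneg hb (t / (1 + l)) hs0 hs1')]
  refine ⟨?_, ?_, fun u hu => hge.trans (hle u (le_of_lt hu))⟩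
  · refine lt_of_le_of_ne ht0 fun h0 => ?_
    subst h0
    have h1 := hge.trans (hle 1 zero_le_one)
    have h2 := reducedLagrangian_neg hb hl hl0 one_pos
    have h3 : reducedLagrangian b l 0 = 0 := by
      have := gibbsDiv_self hb 0
      simp only [reducedLagrangian, zero_div, this, mul_zero, neg_zero]
    linarith
  · by_contra hne
    have h1 := mul_pos hk (gibbsDiv_pos hb hs0 hs1' hne)
    have h2 := hle t ht0
    rw [lagrangian_eq_reduced hb hl] at h2
    linarith

/-- A minimizer of the Lagrangian for `l ≤ -1` has `s = 0`. -/
lemma minimizer_of_le_neg_one (hb : 1 ≤ b) {l : ℝ} (hl : l ≤ -1) {s t : ℝ}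
    (hst : (s, t) ∈ domain b)
    (hmin : ∀ p ∈ domain b, lagrangian b l s t ≤ lagrangian b l p.1 p.2) :
    0 < t ∧ s = 0 ∧ 1 + l * (t * (1 - prob b t)) = 0 := by
  have hb0 : 0 < b := by linarith
  obtain ⟨⟨hs0, hs1⟩, ht0⟩ := hst
  simp only [mem_Ici] at ht0 hs0 hs1
  have hs1' := hs1.trans_lt (uniform_lt_one hb0)
  have hmin0 : ∀ u, 0 ≤ u → lagrangian b l s t ≤ lagrangian b l 0 u := fun u hu =>
    hmin (0, u) ⟨⟨le_rfl, by positivity⟩, hu⟩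
  have hdiff : lagrangian b l s t = lagrangian b l 0 t + (-(1 + l) * entropy b s + t * s) := by
    simp only [lagrangian, gibbsDiv, entropy_zero]; ring
  have hH := entropy_nonneg hb hs0 hs1'
  have hmin' : ∀ u, 0 ≤ u → lagrangian b l 0 t ≤ lagrangian b l 0 u := fun u hu => by
    have h1 := mul_nonneg (by linarith : 0 ≤ -(1 + l)) hH
    have h2 := mul_nonneg ht0 hs0
    have h3 := hmin0 u hu
    linarith
  have hpos : 0 < t := by
    refine lt_of_le_of_ne ht0 fun h0 => ?_
    subst h0
    have h1 := hasDerivAt_lagrangian_zero hb0 l 0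
    have h2 : -(prob b 0 * (1 + l * (0 * (1 - prob b 0)))) < 0 := by
      rw [zero_mul, mul_zero, add_zero, mul_one]
      exact neg_lt_zero.2 (prob_pos hb0 0)
    have h3 : ∀ᶠ u in 𝓝[>] (0 : ℝ), slope (lagrangian b l 0) 0 u < 0 := by
      have := (hasDerivAt_iff_tendsto_slope.1 h1).eventually (gt_mem_nhds h2)
      exact this.filter_mono (nhdsWithin_mono _ (fun t (ht : 0 < t) => ht.ne'))
    obtain ⟨u, hu, hu0⟩ := (h3.and self_mem_nhdsWithin).exists
    have hu0' : (0 : ℝ) < u := hu0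
    rw [slope_def_field, sub_zero, div_neg_iff] at hu
    rcases hu with hu | hu
    · linarith
    · linarith [hmin' u hu0'.le]
  refine ⟨hpos, ?_, ?_⟩
  · by_contra hne
    have hs : 0 < s := lt_of_le_of_ne hs0 (Ne.symm hne)
    have h1 := mul_nonneg (by linarith : 0 ≤ -(1 + l)) hH
    have h2 := mul_pos hpos hs
    have h3 := hmin0 t ht0
    linarith
  · have hloc : IsLocalMin (lagrangian b l 0) t := by
      filter_upwards [Ioi_mem_nhds hpos] with u hu using hmin' u (le_of_lt hu)
    have := hloc.hasDerivAt_eq_zero (hasDerivAt_lagrangian_zero hb0 l t)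
    rw [neg_eq_zero, mul_eq_zero] at this
    exact this.resolve_left (prob_pos hb0 t).ne'

/-- For every multiplier `l ≠ 0` the Lagrangian has at most one minimizer, and it has `t > 0`. -/
theorem lagrangian_minimizer_unique (hb : 1 ≤ b) {l : ℝ} (hl0 : l ≠ 0) {p q : ℝ × ℝ}
    (hp : p ∈ domain b) (hq : q ∈ domain b)
    (hpm : ∀ p' ∈ domain b, lagrangian b l p.1 p.2 ≤ lagrangian b l p'.1 p'.2)
    (hqm : ∀ p' ∈ domain b, lagrangian b l q.1 q.2 ≤ lagrangian b l p'.1 p'.2) :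
    0 < p.2 ∧ p = q := by
  have hb0 : 0 < b := by linarith
  rcases lt_or_ge (-1) l with hl | hl
  · obtain ⟨ht, hs, hm⟩ := minimizer_of_neg_one_lt hb0 hl hl0 hp hpm
    obtain ⟨ht', hs', hm'⟩ := minimizer_of_neg_one_lt hb0 hl hl0 hq hqm
    have h2 : p.2 = q.2 := eq_of_isMinOn_of_deriv_pos
      (fun t _ => hasDerivAt_reducedLagrangian hb0 hl t)
      (fun t _ => hasDerivAt_reducedSlope hb0 l t)
      (fun t ht h => reducedSlope_deriv_pos hb0 hl hl0 ht h) ht ht' hm hm'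
    exact ⟨ht, Prod.ext (by rw [hs, hs', h2]) h2⟩
  · obtain ⟨ht, hs, hm⟩ := minimizer_of_le_neg_one hb hl hp hpm
    obtain ⟨ht', hs', hm'⟩ := minimizer_of_le_neg_one hb hl hq hqm
    have hmono : StrictMonoOn (fun t => t * (1 - prob b t)) (Ioi 0) := fun x hx y hy hxy => by
      have h1 := prob_strictAnti hb0 hxy
      have h2 : x * (1 - prob b x) < y * (1 - prob b x) :=
        mul_lt_mul_of_pos_right hxy (by linarith [prob_lt_one hb0 x])
      have h3 : y * (1 - prob b x) < y * (1 - prob b y) :=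
        mul_lt_mul_of_pos_left (by linarith) hy
      exact h2.trans h3
    have h2 : p.2 = q.2 := hmono.injOn ht ht' (mul_left_cancel₀ hl0 (by
      show l * (p.2 * (1 - prob b p.2)) = l * (q.2 * (1 - prob b q.2))
      linarith))
    exact ⟨ht, Prod.ext (by rw [hs, hs']) h2⟩

/-! ### Convexity from uniqueness of minimizers of linear perturbations -/

/-- The minimum over a compact set `J` of a lower semicontinuous function minus `l x`, as a
function of the slope `l`; it is continuous, even Lipschitz, because `J` is bounded. -/
lemma exists_min_sub_linear {f : ℝ → EReal} {J : Set ℝ} (hJ : IsCompact J)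
    (hlsc : LowerSemicontinuousOn f J) (h0 : ∀ x ∈ J, 0 ≤ f x) (hfin : ∃ x ∈ J, f x < ⊤) :
    ∃ m : ℝ → ℝ, Continuous m ∧ ∀ l : ℝ,
      (∃ x ∈ J, f x + ((-(l * x) : ℝ) : EReal) = m l) ∧
      ∀ x ∈ J, (m l : EReal) ≤ f x + ((-(l * x) : ℝ) : EReal) := by
  have key : ∀ l : ℝ, ∃ m : ℝ, (∃ x ∈ J, f x + ((-(l * x) : ℝ) : EReal) = m) ∧
      ∀ x ∈ J, (m : EReal) ≤ f x + ((-(l * x) : ℝ) : EReal) := fun l => by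
    have hl : LowerSemicontinuousOn (fun x => f x + ((-(l * x) : ℝ) : EReal)) J := by
      have hc : Continuous fun x : ℝ => ((-(l * x) : ℝ) : EReal) :=
        continuous_coe_real_ereal.comp (by fun_prop)
      refine hlsc.add' (hc.lowerSemicontinuous.lowerSemicontinuousOn J) fun x _ => ?_
      exact EReal.continuousAt_add (Or.inr (EReal.coe_ne_bot _)) (Or.inr (EReal.coe_ne_top _))
    obtain ⟨y, hyJ, hy⟩ := hfin
    obtain ⟨x, hx, hmin⟩ := hl.exists_isMinOn ⟨y, hyJ⟩ hJ
    have htop : f x ≠ ⊤ := by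
      intro h
      have h1 : f x + ((-(l * x) : ℝ) : EReal) ≤ f y + ((-(l * y) : ℝ) : EReal) := hmin hyJ
      rw [h, EReal.top_add_coe, top_le_iff] at h1
      exact (EReal.add_lt_top hy.ne (EReal.coe_ne_top _)).ne h1
    have hbot : f x ≠ ⊥ := fun h => by
      have := h0 x hx
      rw [h] at this
      exact absurd this (by simp)
    have e : ((f x).toReal + -(l * x) : ℝ) = f x + ((-(l * x) : ℝ) : EReal) := by
      rw [EReal.coe_add, EReal.coe_toReal htop hbot]
    exact ⟨(f x).toReal + -(l * x), ⟨x, hx, e.symm⟩, fun z hz => e ▸ hmin hz⟩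
  choose m hm using key
  refine ⟨m, ?_, hm⟩
  obtain ⟨C, hC⟩ := hJ.isBounded.exists_norm_le
  have hC0 : 0 ≤ C := by
    obtain ⟨y, hyJ, _⟩ := hfin
    exact (norm_nonneg _).trans (hC y hyJ)
  have hle : ∀ l l', m l' ≤ m l + C * |l' - l| := fun l l' => by
    obtain ⟨x, hx, hxe⟩ := (hm l).1
    have h1 := (hm l').2 x hx
    have h2 : f x + ((-(l' * x) : ℝ) : EReal) = ((m l + (l - l') * x : ℝ) : EReal) := by
      rw [EReal.coe_add, ← hxe, add_assoc, ← EReal.coe_add]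
      congr 2
      ring
    rw [h2, EReal.coe_le_coe_iff] at h1
    have h3 : (l - l') * x ≤ C * |l' - l| := by
      calc (l - l') * x ≤ |(l - l') * x| := le_abs_self _
        _ = |x| * |l' - l| := by rw [abs_mul, abs_sub_comm, mul_comm]
        _ ≤ C * |l' - l| := by gcongr; exact hC x hx
    linarith
  refine (LipschitzWith.of_dist_le_mul (K := C.toNNReal) fun l l' => ?_).continuous
  rw [Real.dist_eq, Real.dist_eq, Real.coe_toNNReal _ hC0, abs_le]
  constructor
  · have := hle l l'
    rw [abs_sub_comm] at this
    linarith
  · linarith [hle l' l]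

/-- If `x ↦ f x - l x` has at most one minimizer for every slope `l`, then `f` lies strictly above
some affine function that touches it at a given interior point: by the intermediate value theorem,
for some `l` the minimum to the left of the point equals the minimum to the right. -/
theorem exists_strict_subgradient {f : ℝ → EReal} {a b z : ℝ}
    (hlsc : LowerSemicontinuousOn f (Icc a b)) (h0 : ∀ x ∈ Icc a b, 0 ≤ f x)
    (hfin : ∀ x ∈ Ico a b, f x < ⊤)
    (huniq : ∀ l : ℝ, ∀ x ∈ Icc a b, ∀ y ∈ Icc a b,
      (∀ w ∈ Icc a b, f x + ((-(l * x) : ℝ) : EReal) ≤ f w + ((-(l * w) : ℝ) : EReal)) →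
      (∀ w ∈ Icc a b, f y + ((-(l * y) : ℝ) : EReal) ≤ f w + ((-(l * w) : ℝ) : EReal)) → x = y)
    (hz : z ∈ Ioo a b) :
    ∃ l : ℝ, ∀ x ∈ Icc a b, x ≠ z → f z + ((l * (x - z) : ℝ) : EReal) < f x := by
  have hreal : ∀ x ∈ Ico a b, ∃ v : ℝ, 0 ≤ v ∧ f x = v := fun x hx => by
    have hx0 := h0 x (Ico_subset_Icc_self hx)
    have hbot : f x ≠ ⊥ := fun h => by
      rw [h] at hx0
      exact absurd hx0 (by simp)
    exact ⟨(f x).toReal, EReal.toReal_nonneg hx0, (EReal.coe_toReal (hfin x hx).ne hbot).symm⟩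
  have hsub₁ : Icc a z ⊆ Icc a b := Icc_subset_Icc_right hz.2.le
  have hsub₂ : Icc z b ⊆ Icc a b := Icc_subset_Icc_left hz.1.le
  obtain ⟨m₁, hc₁, hm₁⟩ := exists_min_sub_linear isCompact_Icc (hlsc.mono hsub₁)
    (fun x hx => h0 x (hsub₁ hx)) ⟨z, ⟨hz.1.le, le_rfl⟩, hfin z ⟨hz.1.le, hz.2⟩⟩
  obtain ⟨m₂, hc₂, hm₂⟩ := exists_min_sub_linear isCompact_Icc (hlsc.mono hsub₂)
    (fun x hx => h0 x (hsub₂ hx)) ⟨z, ⟨le_rfl, hz.2.le⟩, hfin z ⟨hz.1.le, hz.2⟩⟩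
  have hlow : ∀ {J : Set ℝ} {l μ : ℝ}, J ⊆ Icc a b → (∀ x ∈ J, l * x ≤ l * z) →
      (∃ x ∈ J, f x + ((-(l * x) : ℝ) : EReal) = μ) → -(l * z) ≤ μ := by
    rintro J l μ hJ hl ⟨x, hx, hxe⟩
    have h1 : ((-(l * x) : ℝ) : EReal) ≤ μ := by
      rw [← hxe]
      exact le_add_of_nonneg_left (h0 x (hJ hx))
    rw [EReal.coe_le_coe_iff] at h1
    linarith [hl x hx]
  obtain ⟨l₁, hl₁⟩ : ∃ l, m₂ l ≤ m₁ l := by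
    obtain ⟨c, hc1, hc2⟩ := exists_between hz.2
    obtain ⟨v, hv0, hv⟩ := hreal c ⟨(hz.1.trans hc1).le, hc2⟩
    have hcz : 0 < c - z := sub_pos.2 hc1
    have hl0 : 0 ≤ v / (c - z) := by positivity
    refine ⟨v / (c - z), ?_⟩
    have h1 := (hm₂ (v / (c - z))).2 c ⟨hc1.le, hc2.le⟩
    rw [hv, ← EReal.coe_add, EReal.coe_le_coe_iff] at h1
    have h2 := hlow hsub₁ (fun x hx => mul_le_mul_of_nonneg_left hx.2 hl0) (hm₁ _).1
    have h3 : v / (c - z) * (c - z) = v := by field_simp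
    nlinarith
  obtain ⟨l₂, hl₂⟩ : ∃ l, m₁ l ≤ m₂ l := by
    obtain ⟨v, hv0, hv⟩ := hreal a ⟨le_rfl, hz.1.trans hz.2⟩
    have hcz : 0 < z - a := sub_pos.2 hz.1
    have hl0 : -(v / (z - a)) ≤ 0 := neg_nonpos.2 (by positivity)
    refine ⟨-(v / (z - a)), ?_⟩
    have h1 := (hm₁ (-(v / (z - a)))).2 a ⟨le_rfl, hz.1.le⟩
    rw [hv, ← EReal.coe_add, EReal.coe_le_coe_iff] at h1
    have h2 := hlow hsub₂ (fun x hx => mul_le_mul_of_nonpos_left hx.1 hl0) (hm₂ _).1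
    have h3 : v / (z - a) * (z - a) = v := by field_simp
    nlinarith
  obtain ⟨l, hl⟩ : ∃ l, m₁ l = m₂ l := by
    obtain ⟨l, hl⟩ := mem_range_of_exists_le_of_exists_ge (hc₁.sub hc₂) (c := 0)
      ⟨l₂, sub_nonpos.2 hl₂⟩ ⟨l₁, sub_nonneg.2 hl₁⟩
    exact ⟨l, sub_eq_zero.1 hl⟩
  obtain ⟨⟨x₁, hx₁, he₁⟩, hle₁⟩ := hm₁ l
  obtain ⟨⟨x₂, hx₂, he₂⟩, hle₂⟩ := hm₂ l
  have hle : ∀ w ∈ Icc a b, (m₁ l : EReal) ≤ f w + ((-(l * w) : ℝ) : EReal) := fun w hw => by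
    rcases le_total w z with h | h
    · exact hle₁ w ⟨hw.1, h⟩
    · rw [hl]
      exact hle₂ w ⟨h, hw.2⟩
  have hx : x₁ = x₂ := huniq l x₁ (hsub₁ hx₁) x₂ (hsub₂ hx₂) (fun w hw => he₁ ▸ hle w hw)
    (fun w hw => by rw [he₂, ← hl]; exact hle w hw)
  have hxz : x₁ = z := le_antisymm hx₁.2 (hx ▸ hx₂.1)
  subst hxz
  refine ⟨l, fun x hx hne => ?_⟩
  have hlt : f x₁ + ((-(l * x₁) : ℝ) : EReal) < f x + ((-(l * x) : ℝ) : EReal) := by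
    refine lt_of_le_of_ne (he₁ ▸ hle x hx) fun he => hne ?_
    exact huniq l x hx x₁ (hsub₁ hx₁) (fun w hw => by rw [← he, he₁]; exact hle w hw)
      (fun w hw => he₁ ▸ hle w hw)
  obtain ⟨v, -, hv⟩ := hreal x₁ ⟨hz.1.le, hz.2⟩
  by_cases htop : f x = ⊤
  · rw [htop, hv, ← EReal.coe_add]
    exact EReal.coe_lt_top _
  · have hbot : f x ≠ ⊥ := fun h => by
      have := h0 x hx
      rw [h] at this
      exact absurd this (by simp)
    rw [← EReal.coe_toReal htop hbot] at hlt ⊢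
    rw [hv, ← EReal.coe_add, ← EReal.coe_add, EReal.coe_lt_coe_iff] at hlt
    rw [hv, ← EReal.coe_add, EReal.coe_lt_coe_iff]
    linarith

/-- A function between an affine function and a differentiable function that touch at `x` is
differentiable at `x`. -/
lemma hasDerivAt_of_affine_le_of_le {g u : ℝ → ℝ} {l u' x : ℝ}
    (hl : ∀ᶠ y in 𝓝 x, g x + l * (y - x) ≤ g y) (hu : ∀ᶠ y in 𝓝 x, g y ≤ u y)
    (hux : u x = g x) (hd : HasDerivAt u u' x) : HasDerivAt g l x := by
  have hw : HasDerivAt (fun y => u y - (g x + l * (y - x))) (u' - l) x :=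
    (hd.sub ((((hasDerivAt_id x).sub_const x).const_mul l).const_add (g x))).congr_deriv (by simp)
  have hmin : IsLocalMin (fun y => u y - (g x + l * (y - x))) x := by
    filter_upwards [hl, hu] with y h1 h2
    simp only [hux, sub_self, mul_zero, add_zero]
    linarith
  rw [hmin.hasDerivAt_eq_zero hw] at hw
  have hg : HasDerivAt (fun y => g y - (g x + l * (y - x))) 0 x := by
    rw [hasDerivAt_iff_isLittleO] at hw ⊢
    refine Asymptotics.IsBigO.trans_isLittleO ?_ hw
    refine Asymptotics.IsBigO.of_bound 1 ?_
    filter_upwards [hl, hu] with y h1 h2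
    simp only [hux, sub_self, mul_zero, add_zero, smul_zero, sub_zero, one_mul, Real.norm_eq_abs]
    rw [abs_of_nonneg (by linarith), abs_of_nonneg (by linarith)]
    linarith
  have := hg.add ((((hasDerivAt_id x).sub_const x).const_mul l).const_add (g x))
  refine (this.congr_deriv (by simp)).congr_of_eventuallyEq (Eventually.of_forall fun y => ?_)
  simp

/-- A strictly increasing derivative on an open interval is continuous, by Darboux's theorem. -/
lemma contDiffOn_one_of_strictMonoOn {g m : ℝ → ℝ} {a b : ℝ}
    (hd : ∀ x ∈ Ioo a b, HasDerivAt g (m x) x) (hm : StrictMonoOn m (Ioo a b)) :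
    ContDiffOn ℝ 1 g (Ioo a b) := by
  rw [contDiffOn_one_iff_derivWithin isOpen_Ioo.uniqueDiffOn]
  refine ⟨fun x hx => (hd x hx).differentiableAt.differentiableWithinAt, ?_⟩
  have hcont : ContinuousOn m (Ioo a b) := fun x hx => by
    refine (hm.continuousAt_of_image_mem_nhds (isOpen_Ioo.mem_nhds hx) ?_).continuousWithinAt
    obtain ⟨y, hy⟩ := exists_between hx.1
    obtain ⟨w, hw⟩ := exists_between hx.2
    have hy' : y ∈ Ioo a b := ⟨hy.1, hy.2.trans hx.2⟩
    have hw' : w ∈ Ioo a b := ⟨hx.1.trans hw.1, hw.2⟩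
    exact mem_of_superset (Icc_mem_nhds (hm hy' hx hy.2) (hm hx hw' hw.1))
      ((ordConnected_Ioo.image_hasDerivWithinAt fun x hx => (hd x hx).hasDerivWithinAt).out
        (mem_image_of_mem _ hy') (mem_image_of_mem _ hw'))
  exact hcont.congr fun x hx => (hd x hx).hasDerivWithinAt.derivWithin
    (isOpen_Ioo.uniqueDiffOn x hx)

/-! ### The relative entropy with values in the extended reals -/

lemma binRelEntropy_prob (hb : 0 < b) {s : ℝ} (t : ℝ) (h0 : 0 ≤ s) (h1 : s ≤ 1) :
    binRelEntropy s (prob b t) = (gibbsDiv b s t : EReal) := by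
  have term : ∀ {x y : ℝ}, y ≠ 0 → relEntropyTerm x y = ((x * Real.log (x / y) : ℝ) : EReal) := by
    intro x y hy
    unfold relEntropyTerm
    split_ifs with h
    · simp [h]
    · rfl
  rw [binRelEntropy, term (prob_pos hb t).ne', term (by linarith [prob_lt_one hb t]),
    ← EReal.coe_add, gibbsDiv_eq hb t h0 h1]

lemma binRelEntropy_zero_zero : binRelEntropy 0 0 = 0 := by
  simp [binRelEntropy, relEntropyTerm]

lemma binRelEntropy_zero_right {s : ℝ} (h0 : 0 < s) : binRelEntropy s 0 = ⊤ := by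
  have h1 : relEntropyTerm s 0 = ⊤ := by simp [relEntropyTerm, h0.ne']
  have h2 : relEntropyTerm (1 - s) (1 - 0) ≠ ⊥ := by
    unfold relEntropyTerm
    split_ifs <;> first | exact EReal.coe_ne_bot _ | simp
  rw [binRelEntropy, h1, EReal.top_add_of_ne_bot h2]

/-- The square of admissible pairs `(s, r)`. -/
def square (b : ℝ) : Set (ℝ × ℝ) := Icc 0 (b / (b + 1)) ×ˢ Icc 0 (b / (b + 1))

/-- The entropy difference of a pair `(s, r)`. -/
noncomputable def entropyDiff (b : ℝ) (p : ℝ × ℝ) : ℝ := entropy b p.1 - entropy b p.2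

/-- The minimal relative entropy for the entropy difference `x`; this is `boundM x d` if
`b = d - 1`. -/
noncomputable def minRelEntropy (b x : ℝ) : EReal :=
  sInf ((fun p : ℝ × ℝ => binRelEntropy p.1 p.2) '' {p ∈ square b | entropyDiff b p = x})

/-- A pair in the square is `(0, 0)`, or has infinite relative entropy, or is given by a tilting
parameter. -/
lemma square_cases (hb : 0 < b) {p : ℝ × ℝ} (hp : p ∈ square b) :
    p = (0, 0) ∨ (0 < p.1 ∧ p.2 = 0 ∧ binRelEntropy p.1 p.2 = ⊤) ∨
      ∃ t, (p.1, t) ∈ domain b ∧ p.2 = prob b t ∧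
        binRelEntropy p.1 p.2 = (gibbsDiv b p.1 t : EReal) := by
  obtain ⟨⟨hs0, hs1⟩, hr0, hr1⟩ := hp
  rcases hr0.eq_or_lt with hr | hr
  · rcases hs0.eq_or_lt with hs | hs
    · exact Or.inl (Prod.ext hs.symm hr.symm)
    · exact Or.inr (Or.inl ⟨hs, hr.symm, by rw [← hr, binRelEntropy_zero_right hs]⟩)
  · obtain ⟨t, ht, htr⟩ := exists_prob_eq hb hr hr1
    refine Or.inr (Or.inr ⟨t, ⟨⟨hs0, hs1⟩, ht⟩, htr.symm, ?_⟩)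
    rw [← htr, binRelEntropy_prob hb t hs0 (hs1.trans (uniform_lt_one hb).le)]

lemma gibbsDiv_nonneg_of_mem (hb : 0 < b) {s t : ℝ} (h : (s, t) ∈ domain b) :
    0 ≤ gibbsDiv b s t :=
  gibbsDiv_nonneg hb t h.1.1 (h.1.2.trans (uniform_lt_one hb).le)

lemma binRelEntropy_nonneg (hb : 0 < b) {p : ℝ × ℝ} (hp : p ∈ square b) :
    0 ≤ binRelEntropy p.1 p.2 := by
  rcases square_cases hb hp with rfl | ⟨-, -, h⟩ | ⟨t, ht, -, h⟩
  · rw [binRelEntropy_zero_zero]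
  · rw [h]; exact le_top
  · rw [h]; exact_mod_cast gibbsDiv_nonneg_of_mem hb ht

lemma entropyDiff_eq_zero (hb : 0 < b) {p : ℝ × ℝ} (hp : p ∈ square b)
    (h0 : binRelEntropy p.1 p.2 ≤ 0) : entropyDiff b p = 0 := by
  rcases square_cases hb hp with rfl | ⟨-, -, h⟩ | ⟨t, ht, hr, h⟩
  · simp [entropyDiff]
  · rw [h] at h0
    exact absurd h0 (by simp)
  · rw [h] at h0
    have h1 : gibbsDiv b p.1 t ≤ 0 := by exact_mod_cast h0
    have h2 : p.1 = prob b t := by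
      by_contra hne
      exact absurd (gibbsDiv_pos hb ht.1.1 (ht.1.2.trans (uniform_lt_one hb).le) hne) h1.not_gt
    simp [entropyDiff, h2, hr]

lemma mem_square_of_mem_domain (hb : 0 < b) {q : ℝ × ℝ} (hq : q ∈ domain b) :
    (q.1, prob b q.2) ∈ square b := ⟨hq.1, prob_mem hb hq.2⟩

lemma isCompact_square (b : ℝ) : IsCompact (square b) := isCompact_Icc.prod isCompact_Icc

lemma continuous_entropyDiff (b : ℝ) : Continuous (entropyDiff b) :=
  ((continuous_entropy b).comp continuous_fst).sub ((continuous_entropy b).comp continuous_snd)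

/-- The relative entropy is lower semicontinuous. The only delicate points are `(s, 0)`, where it is
continuous as a function into the extended reals if `s > 0`, and minimal if `s = 0`. -/
lemma lowerSemicontinuousOn_binRelEntropy (hb : 1 ≤ b) :
    LowerSemicontinuousOn (fun p : ℝ × ℝ => binRelEntropy p.1 p.2) (square b) := by
  have hb0 : 0 < b := by linarith
  intro p hp
  rcases hp.2.1.eq_or_lt with hr | hr
  · rcases square_cases hb0 hp with rfl | ⟨hs, -, -⟩ | ⟨t, -, h, -⟩
    · intro y hy
      dsimp only at hy
      rw [binRelEntropy_zero_zero] at hy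
      filter_upwards [self_mem_nhdsWithin] with q hq using hy.trans_le (binRelEntropy_nonneg hb0 hq)
    · intro y hy
      have hy' : y < ⊤ := hy.trans_le le_top
      obtain ⟨K, hK⟩ : ∃ K : ℝ, y ≤ K := by
        rcases eq_or_ne y ⊥ with rfl | hbot
        · exact ⟨0, bot_le⟩
        · exact ⟨y.toReal, (EReal.coe_toReal hy'.ne hbot).ge⟩
      set T := 2 * (|K| + Real.log (b + 1) + 1) / p.1 with hT
      have hlog : 0 < Real.log (b + 1) := Real.log_pos (by linarith)
      have hT0 : 0 < T := by positivity
      have h1 : ∀ᶠ q : ℝ × ℝ in 𝓝 p, p.1 / 2 < q.1 :=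
        continuous_fst.continuousAt.eventually (lt_mem_nhds (by linarith))
      have h2 : ∀ᶠ q : ℝ × ℝ in 𝓝 p, q.2 < prob b T :=
        continuous_snd.continuousAt.eventually (gt_mem_nhds (by
          rw [← hr]; exact prob_pos hb0 T))
      filter_upwards [self_mem_nhdsWithin, nhdsWithin_le_nhds h1, nhdsWithin_le_nhds h2]
        with q hq hq1 hq2
      rcases square_cases hb0 hq with rfl | ⟨-, -, h⟩ | ⟨t, ht, hqt, h⟩
      · dsimp only at hq1
        linarith
      · rw [h]; exact hy'
      · rw [h]
        refine hK.trans_lt (EReal.coe_lt_coe_iff.2 ?_)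
        have hTt : T < t := by
          rw [hqt] at hq2
          exact (prob_strictAnti hb0).lt_iff_gt.1 hq2
        have h3 := entropy_le hb0 ht.1.1 (ht.1.2.trans (uniform_lt_one hb0).le)
        have h4 := logPartition_pos hb0 t
        have h5 : T * (p.1 / 2) = |K| + Real.log (b + 1) + 1 := by rw [hT]; field_simp
        have h6 : T * (p.1 / 2) ≤ t * q.1 :=
          mul_le_mul hTt.le hq1.le (by linarith) (by linarith)
        have := le_abs_self K
        unfold gibbsDiv
        linarith
    · exact absurd (h.symm.trans hr.symm) (prob_pos hb0 t).ne'
  · have hr1 : p.2 < 1 := hp.2.2.trans_lt (uniform_lt_one hb0)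
    set G : ℝ × ℝ → ℝ := fun q => gibbsDiv b q.1 (Real.log ((1 - q.2) / q.2 * b)) with hG
    have heq : ∀ q ∈ square b, 0 < q.2 → binRelEntropy q.1 q.2 = (G q : EReal) := fun q hq h => by
      rw [hG, ← binRelEntropy_prob hb0 _ hq.1.1 (hq.1.2.trans (uniform_lt_one hb0).le),
        prob_log hb0 h (hq.2.2.trans_lt (uniform_lt_one hb0))]
    have hcont : ContinuousAt G p := by
      have h1 : ContinuousAt (fun q : ℝ × ℝ => Real.log ((1 - q.2) / q.2 * b)) p := by
        have hne : (1 - p.2) / p.2 * b ≠ 0 := by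
          have : 0 < 1 - p.2 := by linarith
          positivity
        refine ContinuousAt.log ?_ hne
        exact ((continuousAt_const.sub continuous_snd.continuousAt).div continuous_snd.continuousAt
          hr.ne').mul_const b
      have h2 : ContinuousAt (fun q : ℝ × ℝ => logPartition b (Real.log ((1 - q.2) / q.2 * b))) p :=
        (hasDerivAt_logPartition hb0 _).continuousAt.comp h1
      exact (h2.add (h1.mul continuous_fst.continuousAt)).sub
        ((continuous_entropy b).comp continuous_fst).continuousAt
    intro y hy
    dsimp only at hy
    rw [heq p hp hr] at hy
    have h1 : ∀ᶠ q in 𝓝 p, y < (G q : EReal) :=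
      (continuous_coe_real_ereal.continuousAt.comp hcont).eventually (lt_mem_nhds hy)
    have h2 : ∀ᶠ q : ℝ × ℝ in 𝓝 p, 0 < q.2 :=
      continuous_snd.continuousAt.eventually (lt_mem_nhds hr)
    filter_upwards [self_mem_nhdsWithin, nhdsWithin_le_nhds h1, nhdsWithin_le_nhds h2]
      with q hq hq1 hq2
    rw [heq q hq hq2]
    exact hq1

/-! ### The minimal relative entropy -/

lemma exists_entropy_eq (hb : 1 ≤ b) {y : ℝ} (hy : y ∈ Icc 0 (Real.log (b + 1))) :
    ∃ r ∈ Icc 0 (b / (b + 1)), entropy b r = y := by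
  have h := intermediate_value_Icc (a := 0) (b := b / (b + 1)) (by positivity)
    (continuous_entropy b).continuousOn
  rw [entropy_zero, entropy_uniform (by linarith)] at h
  exact h hy

lemma uniform_mem (hb : 1 ≤ b) : b / (b + 1) ∈ Icc 0 (b / (b + 1)) :=
  ⟨by positivity, le_rfl⟩

lemma zero_mem (hb : 1 ≤ b) : (0 : ℝ) ∈ Icc 0 (b / (b + 1)) :=
  ⟨le_rfl, by positivity⟩

lemma entropyDiff_mem (hb : 1 ≤ b) {p : ℝ × ℝ} (hp : p ∈ square b) :
    entropyDiff b p ∈ Icc (-Real.log (b + 1)) (Real.log (b + 1)) := by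
  have hb0 : 0 < b := by linarith
  have h := uniform_lt_one hb0
  have h1 := entropy_le hb0 hp.1.1 (hp.1.2.trans h.le)
  have h2 := entropy_le hb0 hp.2.1 (hp.2.2.trans h.le)
  have h3 := entropy_nonneg hb hp.1.1 (hp.1.2.trans_lt h)
  have h4 := entropy_nonneg hb hp.2.1 (hp.2.2.trans_lt h)
  unfold entropyDiff
  constructor <;> linarith

/-- Every entropy difference less than the maximal one is attained with finite relative entropy. -/
lemma exists_finite_pair (hb : 1 ≤ b) {x : ℝ}
    (hx : x ∈ Ico (-Real.log (b + 1)) (Real.log (b + 1))) :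
    ∃ p ∈ square b, entropyDiff b p = x ∧ binRelEntropy p.1 p.2 < ⊤ := by
  have hb0 : 0 < b := by linarith
  have hpair : ∀ {s y : ℝ}, s ∈ Icc 0 (b / (b + 1)) → 0 < y → y ≤ Real.log (b + 1) →
      ∃ r, (s, r) ∈ square b ∧ entropy b r = y ∧ binRelEntropy s r < ⊤ := by
    intro s y hs hy0 hy1
    obtain ⟨r, hr, hry⟩ := exists_entropy_eq hb ⟨hy0.le, hy1⟩
    refine ⟨r, ⟨hs, hr⟩, hry, ?_⟩
    have hr0 : r ≠ 0 := by
      rintro rfl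
      rw [entropy_zero] at hry
      exact hy0.ne hry
    rcases square_cases hb0 (p := (s, r)) ⟨hs, hr⟩ with h | ⟨-, h, -⟩ | ⟨t, -, -, h⟩
    · exact absurd (Prod.ext_iff.1 h).2 hr0
    · exact absurd h hr0
    · dsimp only at h
      rw [h]
      exact EReal.coe_lt_top _
  rcases le_or_gt 0 x with h | h
  · obtain ⟨r, hr, hry, hlt⟩ := hpair (y := Real.log (b + 1) - x) (uniform_mem hb)
      (by linarith [hx.2]) (by linarith)
    refine ⟨_, hr, ?_, hlt⟩
    rw [entropyDiff, hry, entropy_uniform hb0]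
    ring
  · obtain ⟨r, hr, hry, hlt⟩ := hpair (y := -x) (zero_mem hb) (by linarith) (by linarith [hx.1])
    refine ⟨_, hr, ?_, hlt⟩
    rw [entropyDiff, hry, entropy_zero]
    ring

lemma entropyDiff_corner (hb : 1 ≤ b) : entropyDiff b (b / (b + 1), 0) = Real.log (b + 1) := by
  rw [entropyDiff, entropy_uniform (by linarith), entropy_zero, sub_zero]

lemma minRelEntropy_le {p : ℝ × ℝ} (hp : p ∈ square b) :
    minRelEntropy b (entropyDiff b p) ≤ binRelEntropy p.1 p.2 :=
  sInf_le ⟨p, ⟨hp, rfl⟩, rfl⟩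

lemma le_minRelEntropy {x : ℝ} {c : EReal}
    (h : ∀ p ∈ square b, entropyDiff b p = x → c ≤ binRelEntropy p.1 p.2) :
    c ≤ minRelEntropy b x := by
  refine le_sInf ?_
  rintro _ ⟨p, ⟨hp, hpx⟩, rfl⟩
  exact h p hp hpx

lemma minRelEntropy_eq_top (hb : 1 ≤ b) {x : ℝ}
    (hx : x ∉ Icc (-Real.log (b + 1)) (Real.log (b + 1))) : minRelEntropy b x = ⊤ := by
  refine top_le_iff.1 (le_minRelEntropy fun p hp hpx => ?_)
  exact absurd (hpx ▸ entropyDiff_mem hb hp) hx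

lemma isLeast_minRelEntropy (hb : 1 ≤ b) {x : ℝ}
    (hx : x ∈ Icc (-Real.log (b + 1)) (Real.log (b + 1))) :
    IsLeast ((fun p : ℝ × ℝ => binRelEntropy p.1 p.2) '' {p ∈ square b | entropyDiff b p = x})
      (minRelEntropy b x) := by
  have hne : {p ∈ square b | entropyDiff b p = x}.Nonempty := by
    rcases hx.2.eq_or_lt with h | h
    · exact ⟨_, ⟨uniform_mem hb, zero_mem hb⟩, by rw [entropyDiff_corner hb, h]⟩
    · obtain ⟨p, hp, hpx, -⟩ := exists_finite_pair hb ⟨hx.1, h⟩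
      exact ⟨p, hp, hpx⟩
  have hcomp : IsCompact {p ∈ square b | entropyDiff b p = x} :=
    (isCompact_square b).inter_right (isClosed_eq (continuous_entropyDiff b) continuous_const)
  obtain ⟨p, hp, hmin⟩ := ((lowerSemicontinuousOn_binRelEntropy hb).mono
    (sep_subset _ _)).exists_isMinOn hne hcomp
  have : IsLeast ((fun p : ℝ × ℝ => binRelEntropy p.1 p.2) ''
      {p ∈ square b | entropyDiff b p = x}) (binRelEntropy p.1 p.2) :=
    ⟨⟨p, hp, rfl⟩, by rintro _ ⟨q, hq, rfl⟩; exact hmin hq⟩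
  rw [minRelEntropy, this.csInf_eq]
  exact this

lemma exists_minRelEntropy_eq (hb : 1 ≤ b) {x : ℝ}
    (hx : x ∈ Icc (-Real.log (b + 1)) (Real.log (b + 1))) :
    ∃ p ∈ square b, entropyDiff b p = x ∧ minRelEntropy b x = binRelEntropy p.1 p.2 := by
  obtain ⟨p, ⟨hp, hpx⟩, h⟩ := (isLeast_minRelEntropy hb hx).1
  exact ⟨p, hp, hpx, h.symm⟩

lemma minRelEntropy_nonneg (hb : 0 < b) (x : ℝ) : 0 ≤ minRelEntropy b x :=
  le_minRelEntropy fun _ hp _ => binRelEntropy_nonneg hb hp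

lemma minRelEntropy_lt_top (hb : 1 ≤ b) {x : ℝ}
    (hx : x ∈ Ico (-Real.log (b + 1)) (Real.log (b + 1))) : minRelEntropy b x < ⊤ := by
  obtain ⟨p, hp, rfl, h⟩ := exists_finite_pair hb hx
  exact (minRelEntropy_le hp).trans_lt h

lemma minRelEntropy_zero (hb : 1 ≤ b) : minRelEntropy b 0 = 0 := by
  refine le_antisymm ?_ (minRelEntropy_nonneg (by linarith) 0)
  have := minRelEntropy_le (p := (0, 0)) ⟨zero_mem hb, zero_mem hb⟩
  rwa [entropyDiff, sub_self, binRelEntropy_zero_zero] at this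

lemma eq_uniform_of_le_entropy (hb : 0 < b) {s : ℝ} (hs : s ∈ Icc 0 (b / (b + 1)))
    (h : Real.log (b + 1) ≤ entropy b s) : s = b / (b + 1) := by
  by_contra hne
  exact absurd (entropy_lt hb hs.1 (hs.2.trans (uniform_lt_one hb).le) hne) h.not_gt

lemma eq_zero_of_entropy_le (hb : 1 ≤ b) {s : ℝ} (hs : s ∈ Icc 0 (b / (b + 1)))
    (h : entropy b s ≤ 0) : s = 0 := by
  by_contra hne
  exact absurd (entropy_pos hb (lt_of_le_of_ne hs.1 (Ne.symm hne))
    (hs.2.trans_lt (uniform_lt_one (by linarith)))) h.not_gt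

lemma minRelEntropy_right (hb : 1 ≤ b) : minRelEntropy b (Real.log (b + 1)) = ⊤ := by
  have hb0 : 0 < b := by linarith
  refine top_le_iff.1 (le_minRelEntropy fun p hp hpx => ?_)
  have h1 := entropy_nonneg hb hp.2.1 (hp.2.2.trans_lt (uniform_lt_one hb0))
  have h2 := entropy_le hb0 hp.1.1 (hp.1.2.trans (uniform_lt_one hb0).le)
  unfold entropyDiff at hpx
  have h3 := eq_zero_of_entropy_le hb hp.2 (by linarith)
  have h4 := eq_uniform_of_le_entropy hb0 hp.1 (by linarith)
  rw [h3, h4, binRelEntropy_zero_right (by positivity)]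

lemma minRelEntropy_left (hb : 1 ≤ b) :
    minRelEntropy b (-Real.log (b + 1)) = (Real.log (b + 1) : ℝ) := by
  have hb0 : 0 < b := by linarith
  have hlog : 0 < Real.log (b + 1) := Real.log_pos (by linarith)
  obtain ⟨p, hp, hpx, h⟩ := exists_minRelEntropy_eq hb (x := -Real.log (b + 1))
    ⟨le_rfl, by linarith⟩
  have h1 := entropy_nonneg hb hp.1.1 (hp.1.2.trans_lt (uniform_lt_one hb0))
  have h2 := entropy_le hb0 hp.2.1 (hp.2.2.trans (uniform_lt_one hb0).le)
  unfold entropyDiff at hpx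
  have h3 := eq_zero_of_entropy_le hb hp.1 (by linarith)
  have h4 := eq_uniform_of_le_entropy hb0 hp.2 (by linarith)
  rw [h, h3, h4, ← prob_zero, binRelEntropy_prob hb0 0 le_rfl zero_le_one, gibbsDiv, entropy_zero,
    logPartition_zero, add_comm 1 b]
  simp

/-- The sublevel sets of the minimum are images of sublevel sets of the relative entropy. -/
lemma lowerSemicontinuousOn_minRelEntropy (hb : 1 ≤ b) :
    LowerSemicontinuousOn (minRelEntropy b) (Icc (-Real.log (b + 1)) (Real.log (b + 1))) := by
  rw [lowerSemicontinuousOn_iff_preimage_Iic]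
  intro c
  obtain ⟨v, hv, hvc⟩ :=
    lowerSemicontinuousOn_iff_preimage_Iic.1 (lowerSemicontinuousOn_binRelEntropy hb) c
  have hcomp : IsCompact (entropyDiff b '' (square b ∩ v)) :=
    ((isCompact_square b).inter_right hv).image (continuous_entropyDiff b)
  refine ⟨_, hcomp.isClosed, ?_⟩
  rw [← hvc]
  ext x
  constructor
  · rintro ⟨hx, hxc⟩
    obtain ⟨p, hp, hpx, h⟩ := exists_minRelEntropy_eq hb hx
    refine ⟨hx, p, ⟨hp, ?_⟩, hpx⟩
    rw [mem_preimage, h] at hxc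
    exact hxc
  · rintro ⟨hx, p, ⟨hp, hpc⟩, rfl⟩
    exact ⟨hx, (minRelEntropy_le hp).trans hpc⟩

/-- A minimizer `x` of `minRelEntropy b x - l x`, `l ≠ 0`, comes from a minimizer of the
Lagrangian. -/
lemma exists_lagrangian_minimizer (hb : 1 ≤ b) {l x : ℝ} (hl : l ≠ 0)
    (hx : x ∈ Icc (-Real.log (b + 1)) (Real.log (b + 1)))
    (hmin : ∀ w ∈ Icc (-Real.log (b + 1)) (Real.log (b + 1)),
      minRelEntropy b x + ((-(l * x) : ℝ) : EReal) ≤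
        minRelEntropy b w + ((-(l * w) : ℝ) : EReal)) :
    ∃ q ∈ domain b, entropyDiff b (q.1, prob b q.2) = x ∧
      minRelEntropy b x = (gibbsDiv b q.1 q.2 : EReal) ∧
      ∀ q' ∈ domain b, lagrangian b l q.1 q.2 ≤ lagrangian b l q'.1 q'.2 := by
  have hb0 : 0 < b := by linarith
  have hle : ∀ q' ∈ domain b,
      minRelEntropy b x + ((-(l * x) : ℝ) : EReal) ≤ (lagrangian b l q'.1 q'.2 : EReal) := by
    intro q' hq'
    have hm := mem_square_of_mem_domain hb0 hq'
    refine (hmin _ (entropyDiff_mem hb hm)).trans ?_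
    have h1 := minRelEntropy_le hm
    rw [binRelEntropy_prob hb0 _ hq'.1.1 (hq'.1.2.trans (uniform_lt_one hb0).le)] at h1
    refine (add_le_add_left h1 _).trans ?_
    rw [← EReal.coe_add, EReal.coe_le_coe_iff, lagrangian, entropyDiff]
    linarith
  obtain ⟨q₀, hq₀, hneg⟩ := exists_lagrangian_neg hb0 hl
  obtain ⟨p, hp, hpx, h⟩ := exists_minRelEntropy_eq hb hx
  rcases square_cases hb0 hp with rfl | ⟨-, -, htop⟩ | ⟨t, ht, hr, hg⟩
  · have h1 := hle q₀ hq₀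
    have hx0 : x = 0 := by rw [← hpx, entropyDiff, sub_self]
    rw [h, binRelEntropy_zero_zero, hx0, mul_zero, neg_zero, zero_add, EReal.coe_le_coe_iff] at h1
    linarith
  · have h1 := hle q₀ hq₀
    rw [h, htop, EReal.top_add_coe, top_le_iff] at h1
    exact absurd h1 (EReal.coe_ne_top _)
  · refine ⟨(p.1, t), ht, ?_, by rw [h, hg], fun q' hq' => ?_⟩
    · rw [← hpx, ← hr]
    · have h1 := hle q' hq'
      rw [h, hg, ← EReal.coe_add, EReal.coe_le_coe_iff] at h1
      refine le_trans (le_of_eq ?_) h1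
      rw [lagrangian, ← hpx, entropyDiff, hr]
      ring

lemma minRelEntropy_minimizer_unique (hb : 1 ≤ b) (l : ℝ) {x y : ℝ}
    (hx : x ∈ Icc (-Real.log (b + 1)) (Real.log (b + 1)))
    (hy : y ∈ Icc (-Real.log (b + 1)) (Real.log (b + 1)))
    (hxm : ∀ w ∈ Icc (-Real.log (b + 1)) (Real.log (b + 1)),
      minRelEntropy b x + ((-(l * x) : ℝ) : EReal) ≤
        minRelEntropy b w + ((-(l * w) : ℝ) : EReal))
    (hym : ∀ w ∈ Icc (-Real.log (b + 1)) (Real.log (b + 1)),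
      minRelEntropy b y + ((-(l * y) : ℝ) : EReal) ≤
        minRelEntropy b w + ((-(l * w) : ℝ) : EReal)) : x = y := by
  rcases eq_or_ne l 0 with rfl | hl
  · have h0 : ∀ {z : ℝ}, z ∈ Icc (-Real.log (b + 1)) (Real.log (b + 1)) →
        (∀ w ∈ Icc (-Real.log (b + 1)) (Real.log (b + 1)),
          minRelEntropy b z + ((-(0 * z) : ℝ) : EReal) ≤
            minRelEntropy b w + ((-(0 * w) : ℝ) : EReal)) → z = 0 := by
      intro z hz hzm
      have h1 := hzm 0 ⟨by linarith [hz.1, hz.2], by linarith [hz.1, hz.2]⟩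
      simp only [zero_mul, neg_zero, EReal.coe_zero, add_zero, minRelEntropy_zero hb] at h1
      obtain ⟨p, hp, hpz, h⟩ := exists_minRelEntropy_eq hb hz
      rw [← hpz]
      exact entropyDiff_eq_zero (by linarith) hp (h ▸ h1)
    rw [h0 hx hxm, h0 hy hym]
  · obtain ⟨p, hp, hpx, -, hpm⟩ := exists_lagrangian_minimizer hb hl hx hxm
    obtain ⟨q, hq, hqy, -, hqm⟩ := exists_lagrangian_minimizer hb hl hy hym
    rw [← hpx, ← hqy, (lagrangian_minimizer_unique hb hl hp hq hpm hqm).2]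

/-! ### Strict convexity, differentiability and continuity of the minimum -/

lemma minRelEntropy_eq_coe (hb : 1 ≤ b) {x : ℝ}
    (hx : x ∈ Ico (-Real.log (b + 1)) (Real.log (b + 1))) :
    minRelEntropy b x = ((minRelEntropy b x).toReal : EReal) := by
  refine (EReal.coe_toReal (minRelEntropy_lt_top hb hx).ne fun h => ?_).symm
  have := minRelEntropy_nonneg (by linarith) x (b := b)
  rw [h] at this
  exact absurd this (by simp)

lemma minRelEntropy_strict_subgradient (hb : 1 ≤ b) {z : ℝ}
    (hz : z ∈ Ioo (-Real.log (b + 1)) (Real.log (b + 1))) :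
    ∃ l : ℝ, ∀ x ∈ Icc (-Real.log (b + 1)) (Real.log (b + 1)), x ≠ z →
      minRelEntropy b z + ((l * (x - z) : ℝ) : EReal) < minRelEntropy b x :=
  exists_strict_subgradient (lowerSemicontinuousOn_minRelEntropy hb)
    (fun x _ => minRelEntropy_nonneg (by linarith) x) (fun _ hx => minRelEntropy_lt_top hb hx)
    (fun l _ hx _ hy hxm hym => minRelEntropy_minimizer_unique hb l hx hy hxm hym) hz

lemma minRelEntropy_strictConvex (hb : 1 ≤ b) {x y : ℝ}
    (hx : x ∈ Icc (-Real.log (b + 1)) (Real.log (b + 1)))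
    (hy : y ∈ Icc (-Real.log (b + 1)) (Real.log (b + 1))) (hxy : x ≠ y) {u v : ℝ} (hu : 0 < u)
    (hv : 0 < v) (huv : u + v = 1) :
    minRelEntropy b (u * x + v * y) <
      (u : EReal) * minRelEntropy b x + (v : EReal) * minRelEntropy b y := by
  have hb0 : 0 < b := by linarith
  set z := u * x + v * y with hz
  have hzx : x - z = v * (x - y) := by rw [hz]; linear_combination -x * huv
  have hzy : y - z = u * (y - x) := by rw [hz]; linear_combination -y * huv
  have hzI : z ∈ Ioo (-Real.log (b + 1)) (Real.log (b + 1)) := by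
    rcases lt_or_gt_of_ne hxy with h | h
    · have h1 := mul_pos hv (sub_pos.2 h)
      have h2 := mul_pos hu (sub_pos.2 h)
      constructor <;> linarith [hx.1, hx.2, hy.1, hy.2]
    · have h1 := mul_pos hv (sub_pos.2 h)
      have h2 := mul_pos hu (sub_pos.2 h)
      constructor <;> linarith [hx.1, hx.2, hy.1, hy.2]
  obtain ⟨l, hl⟩ := minRelEntropy_strict_subgradient hb hzI
  have hlx := hl x hx (sub_ne_zero.1 (hzx ▸ mul_ne_zero hv.ne' (sub_ne_zero.2 hxy)))
  have hly := hl y hy (sub_ne_zero.1 (hzy ▸ mul_ne_zero hu.ne' (sub_ne_zero.2 hxy.symm)))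
  have hzr := minRelEntropy_eq_coe hb ⟨hzI.1.le, hzI.2⟩
  have hcase : ∀ w, minRelEntropy b w = ⊤ ∨ ∃ c : ℝ, minRelEntropy b w = c := fun w => by
    by_cases h : minRelEntropy b w = ⊤
    · exact Or.inl h
    · refine Or.inr ⟨_, (EReal.coe_toReal h fun h' => ?_).symm⟩
      have := minRelEntropy_nonneg hb0 w
      rw [h'] at this
      exact absurd this (by simp)
  have hnonneg : ∀ {c : ℝ} (w : ℝ), 0 < c → (c : EReal) * minRelEntropy b w ≠ ⊥ := fun w hc h => by
    have := mul_nonneg (EReal.coe_nonneg.2 hc.le) (minRelEntropy_nonneg hb0 w)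
    rw [h] at this
    exact absurd this (by simp)
  rcases hcase x with hxt | ⟨c, hc⟩
  · rw [hxt, EReal.coe_mul_top_of_pos hu, EReal.top_add_of_ne_bot (hnonneg y hv), hzr]
    exact EReal.coe_lt_top _
  rcases hcase y with hyt | ⟨c', hc'⟩
  · rw [hyt, EReal.coe_mul_top_of_pos hv, EReal.add_top_of_ne_bot (hnonneg x hu), hzr]
    exact EReal.coe_lt_top _
  rw [hzr, hc, ← EReal.coe_add, EReal.coe_lt_coe_iff] at hlx
  rw [hzr, hc', ← EReal.coe_add, EReal.coe_lt_coe_iff] at hly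
  rw [hzr, hc, hc', ← EReal.coe_mul, ← EReal.coe_mul, ← EReal.coe_add, EReal.coe_lt_coe_iff]
  have h1 := mul_lt_mul_of_pos_left hlx hu
  have h2 := mul_lt_mul_of_pos_left hly hv
  rw [hzx] at h1
  rw [hzy] at h2
  generalize (minRelEntropy b z).toReal = e at *
  have h3 : u * (e + l * (v * (x - y))) + v * (e + l * (u * (y - x))) = e := by
    linear_combination e * huv
  linarith

/-- The minimum at an interior point is attained at a pair with `0 < r < b / (b + 1)`. -/
lemma exists_interior_minimizer (hb : 1 ≤ b) {z l : ℝ}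
    (hz : z ∈ Ioo (-Real.log (b + 1)) (Real.log (b + 1)))
    (hl : ∀ x ∈ Icc (-Real.log (b + 1)) (Real.log (b + 1)), x ≠ z →
      minRelEntropy b z + ((l * (x - z) : ℝ) : EReal) < minRelEntropy b x) :
    ∃ s t, (s, t) ∈ domain b ∧ 0 < t ∧ entropyDiff b (s, prob b t) = z ∧
      minRelEntropy b z = (gibbsDiv b s t : EReal) := by
  have hb0 : 0 < b := by linarith
  rcases eq_or_ne l 0 with rfl | hl0
  · have hz0 : z = 0 := by
      by_contra hne
      have h1 := hl 0 ⟨by linarith [hz.1, hz.2], by linarith [hz.1, hz.2]⟩ (Ne.symm hne)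
      rw [minRelEntropy_zero hb, zero_mul, EReal.coe_zero, add_zero] at h1
      exact absurd (minRelEntropy_nonneg hb0 z) h1.not_ge
    refine ⟨prob b 1, 1, ⟨prob_mem hb0 zero_le_one, zero_le_one' ℝ⟩, one_pos, ?_, ?_⟩
    · rw [entropyDiff, sub_self, hz0]
    · rw [hz0, minRelEntropy_zero hb, gibbsDiv_self hb0, EReal.coe_zero]
  · have hzr := minRelEntropy_eq_coe hb ⟨hz.1.le, hz.2⟩
    obtain ⟨q, hq, hqz, hqv, hqm⟩ := exists_lagrangian_minimizer hb hl0 ⟨hz.1.le, hz.2.le⟩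
      (fun w hw => by
        by_cases hwz : w = z
        · rw [hwz]
        · have h1 := hl w hw hwz
          have h2 : minRelEntropy b z + ((-(l * z) : ℝ) : EReal)
              = minRelEntropy b z + ((l * (w - z) : ℝ) : EReal) + ((-(l * w) : ℝ) : EReal) := by
            rw [add_assoc, ← EReal.coe_add]
            congr 2
            ring
          rw [h2]
          exact add_le_add_left h1.le _)
    exact ⟨q.1, q.2, hq, (lagrangian_minimizer_unique hb hl0 hq hq hqm hqm).1, hqz, hqv⟩

/-- Moving only `r` away from a minimizing pair gives a differentiable upper bound which touches the
minimum, so the subgradient is the derivative. -/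
lemma hasDerivAt_minRelEntropy (hb : 1 ≤ b) {z l : ℝ}
    (hz : z ∈ Ioo (-Real.log (b + 1)) (Real.log (b + 1)))
    (hl : ∀ x ∈ Icc (-Real.log (b + 1)) (Real.log (b + 1)), x ≠ z →
      minRelEntropy b z + ((l * (x - z) : ℝ) : EReal) < minRelEntropy b x) :
    HasDerivAt (fun x => (minRelEntropy b x).toReal) l z := by
  have hb0 : 0 < b := by linarith
  obtain ⟨s, t, hst, ht, hz', hv⟩ := exists_interior_minimizer hb hz hl
  set E : ℝ → ℝ := fun t => entropy b (prob b t) with hE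
  have hprob := continuous_prob hb0
  have hstrict : HasStrictDerivAt E (-(t * (prob b t * (1 - prob b t)))) t :=
    hasStrictDerivAt_of_hasDerivAt_of_continuousAt
      (Eventually.of_forall fun t => hasDerivAt_entropy_prob hb0 t)
      (by fun_prop)
  have hne : -(t * (prob b t * (1 - prob b t))) ≠ 0 := by
    have h1 := prob_pos hb0 t
    have h2 : 0 < 1 - prob b t := by linarith [prob_lt_one hb0 t]
    exact neg_ne_zero.2 (by positivity)
  set τ := hstrict.localInverse E _ t hne with hτ
  have hτd : HasStrictDerivAt τ _ (E t) := hstrict.to_localInverse hne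
  have hτE : ∀ᶠ y in 𝓝 (E t), E (τ y) = y := hstrict.eventually_right_inverse hne
  have hτt : τ (E t) = t := (hstrict.eventually_left_inverse hne).self_of_nhds
  have hzE : entropy b s - z = E t := by
    rw [← hz', hE, entropyDiff]
    ring
  have hτd' : HasDerivAt τ _ (entropy b s - z) := hzE ▸ hτd.hasDerivAt
  have hcomp : HasDerivAt (fun x => τ (entropy b s - x)) _ z :=
    hτd'.comp z ((hasDerivAt_id z).const_sub (entropy b s))
  have hud : HasDerivAt (fun x => gibbsDiv b s (τ (entropy b s - x))) _ z :=
    (hasDerivAt_gibbsDiv hb0 s _).comp z hcomp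
  refine hasDerivAt_of_affine_le_of_le ?_ ?_ ?_ hud
  · filter_upwards [isOpen_Ioo.mem_nhds hz] with x hx
    by_cases hxz : x = z
    · rw [hxz]; simp
    · have h1 := hl x ⟨hx.1.le, hx.2.le⟩ hxz
      rw [minRelEntropy_eq_coe hb ⟨hz.1.le, hz.2⟩, minRelEntropy_eq_coe hb ⟨hx.1.le, hx.2⟩,
        ← EReal.coe_add, EReal.coe_lt_coe_iff] at h1
      exact h1.le
  · have htend : Tendsto (fun x => entropy b s - x) (𝓝 z) (𝓝 (E t)) := by
      rw [← hzE]
      exact (continuous_const.sub continuous_id).tendsto z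
    have hpos : ∀ᶠ x in 𝓝 z, 0 < τ (entropy b s - x) := by
      refine hcomp.continuousAt.eventually (lt_mem_nhds ?_)
      show 0 < τ (entropy b s - z)
      rw [hzE, hτt]
      exact ht
    filter_upwards [isOpen_Ioo.mem_nhds hz, htend.eventually hτE, hpos] with x hx hxE hxpos
    have hmem : (s, τ (entropy b s - x)) ∈ domain b := ⟨hst.1, hxpos.le⟩
    have hdiff : entropyDiff b (s, prob b (τ (entropy b s - x))) = x := by
      have : entropy b (prob b (τ (entropy b s - x))) = entropy b s - x := hxE
      rw [entropyDiff, this]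
      ring
    have h1 := minRelEntropy_le (mem_square_of_mem_domain hb0 hmem)
    rw [binRelEntropy_prob hb0 _ hst.1.1 (hst.1.2.trans (uniform_lt_one hb0).le), hdiff,
      minRelEntropy_eq_coe hb ⟨hx.1.le, hx.2⟩, EReal.coe_le_coe_iff] at h1
    exact h1
  · rw [hzE, hτt, hv, EReal.toReal_coe]

lemma contDiffOn_minRelEntropy (hb : 1 ≤ b) :
    ContDiffOn ℝ 1 (fun x => (minRelEntropy b x).toReal)
      (Ioo (-Real.log (b + 1)) (Real.log (b + 1))) := by
  choose! m hm using fun z hz => minRelEntropy_strict_subgradient hb (z := z) hz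
  refine contDiffOn_one_of_strictMonoOn (m := m)
    (fun z hz => hasDerivAt_minRelEntropy hb hz (hm z hz)) fun x hx y hy hxy => ?_
  have h1 := hm x hx y ⟨hy.1.le, hy.2.le⟩ hxy.ne'
  have h2 := hm y hy x ⟨hx.1.le, hx.2.le⟩ hxy.ne
  rw [minRelEntropy_eq_coe hb ⟨hx.1.le, hx.2⟩, minRelEntropy_eq_coe hb ⟨hy.1.le, hy.2⟩,
    ← EReal.coe_add, EReal.coe_lt_coe_iff] at h1 h2
  nlinarith

lemma continuousOn_minRelEntropy (hb : 1 ≤ b) :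
    ContinuousOn (minRelEntropy b) (Icc (-Real.log (b + 1)) (Real.log (b + 1))) := by
  have hlog : 0 < Real.log (b + 1) := Real.log_pos (by linarith)
  have hlsc := lowerSemicontinuousOn_minRelEntropy hb
  intro x hx
  refine tendsto_order.2 ⟨fun y hy => hlsc x hx y hy, fun y hy => ?_⟩
  rcases hx.2.eq_or_lt with hxr | hxr
  · rw [hxr, minRelEntropy_right hb] at hy
    exact absurd hy not_top_lt
  rcases hx.1.eq_or_lt with hxl | hxl
  · -- On `[-log (b + 1), 0]` convexity bounds the function by its value at the left end.
    rw [← hxl, minRelEntropy_left hb] at hy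
    filter_upwards [self_mem_nhdsWithin, nhdsWithin_le_nhds (gt_mem_nhds (hxl ▸ by linarith :
      x < 0))] with z hz hz0
    refine lt_of_le_of_lt ?_ hy
    rcases hz.1.eq_or_lt with h | h
    · rw [← h, minRelEntropy_left hb]
    · have hconv := minRelEntropy_strictConvex hb (x := -Real.log (b + 1)) (y := 0)
        ⟨le_rfl, by linarith⟩ ⟨by linarith, hlog.le⟩ (by linarith)
        (u := -z / Real.log (b + 1)) (v := 1 - -z / Real.log (b + 1))
        (div_pos (by linarith) hlog) (by rw [sub_pos, div_lt_one hlog]; linarith) (by ring)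
      have e : -z / Real.log (b + 1) * -Real.log (b + 1) + (1 - -z / Real.log (b + 1)) * 0 = z := by
        field_simp
        ring
      rw [e, minRelEntropy_left hb, minRelEntropy_zero hb, mul_zero, add_zero,
        ← EReal.coe_mul, div_mul_cancel₀ _ hlog.ne'] at hconv
      exact hconv.le.trans (EReal.coe_le_coe_iff.2 (by linarith))
  · obtain ⟨l, hl⟩ := minRelEntropy_strict_subgradient hb ⟨hxl, hxr⟩
    have hcont := (hasDerivAt_minRelEntropy hb ⟨hxl, hxr⟩ hl).continuousAt
    rw [minRelEntropy_eq_coe hb ⟨hxl.le, hxr⟩] at hy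
    have h1 : ∀ᶠ w in 𝓝 x, ((minRelEntropy b w).toReal : EReal) < y :=
      (continuous_coe_real_ereal.continuousAt.comp hcont).eventually (gt_mem_nhds hy)
    filter_upwards [nhdsWithin_le_nhds h1, nhdsWithin_le_nhds (isOpen_Ioo.mem_nhds ⟨hxl, hxr⟩)]
      with w hw hwI
    rw [minRelEntropy_eq_coe hb ⟨hwI.1.le, hwI.2⟩]
    exact hw

/-! ### Lower bounds -/

/-- A function with nonnegative second derivative is minimal at a critical point. -/
lemma le_of_deriv_eq_zero_of_deriv2_nonneg {D : Set ℝ} (hD : Convex ℝ D) (hDo : IsOpen D)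
    {f f' f'' : ℝ → ℝ} (hf : ∀ x ∈ D, HasDerivAt f (f' x) x)
    (hf' : ∀ x ∈ D, HasDerivAt f' (f'' x) x) (hnonneg : ∀ x ∈ D, 0 ≤ f'' x) {x₀ x : ℝ}
    (hx₀ : x₀ ∈ D) (h0 : f' x₀ = 0) (hx : x ∈ D) : f x₀ ≤ f x := by
  have hconv : ConvexOn ℝ D f := by
    refine convexOn_of_hasDerivWithinAt2_nonneg hD (f' := f') (f'' := f'')
      (fun x hx => (hf x hx).continuousAt.continuousWithinAt) ?_ ?_ ?_ <;>
      rw [hDo.interior_eq]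
    · exact fun x hx => (hf x hx).hasDerivWithinAt
    · exact fun x hx => (hf' x hx).hasDerivWithinAt
    · exact hnonneg
  refine hconv.isMinOn_of_rightDeriv_eq_zero (by rwa [hDo.interior_eq]) ?_ hx
  rw [(hf x₀ hx₀).hasDerivWithinAt.derivWithin (uniqueDiffWithinAt_Ioi x₀), h0]

lemma cubic_le_exp (x : ℝ) : 1 + x + x ^ 2 / 2 + x ^ 3 / 6 ≤ Real.exp x := by
  have h := le_of_deriv_eq_zero_of_deriv2_nonneg convex_univ isOpen_univ
    (f := fun x => Real.exp x - (1 + x + x ^ 2 / 2 + x ^ 3 / 6))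
    (f' := fun x => Real.exp x - (1 + x + x ^ 2 / 2)) (f'' := fun x => Real.exp x - (1 + x))
    (fun x _ => by
      have := (Real.hasDerivAt_exp x).sub ((((hasDerivAt_id x).const_add 1).add
        ((hasDerivAt_pow 2 x).div_const 2)).add ((hasDerivAt_pow 3 x).div_const 6))
      exact this.congr_deriv (by simp; ring))
    (fun x _ => by
      have := (Real.hasDerivAt_exp x).sub (((hasDerivAt_id x).const_add 1).add
        ((hasDerivAt_pow 2 x).div_const 2))
      exact this.congr_deriv (by simp))
    (fun x _ => by linarith [Real.add_one_le_exp x])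
    (mem_univ 0) (by simp) (mem_univ x)
  simp only [Real.exp_zero] at h
  linarith

/-- The variance of the surprisal in the tilting parameter: `varSurprisal d r` for
`r = prob (d - 1) t`. Up to the factor `t ^ 2` it is the second derivative of `logPartition b`. -/
noncomputable def tiltVariance (b t : ℝ) : ℝ := t ^ 2 * (prob b t * (1 - prob b t))

lemma continuous_tiltVariance (hb : 0 < b) : Continuous (tiltVariance b) := by
  have := continuous_prob hb
  unfold tiltVariance
  fun_prop

lemma prob_log_self (hb : 0 < b) : prob b (Real.log b) = 1 / 2 := by
  rw [prob, Real.exp_log hb]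
  field_simp
  ring

/-- A bound on the variance for `r < 1 / 2` extends to all `t > 0`, because for `1 / 2 ≤ r` both
factors `r (1 - r)` and `t ^ 2` are at most their values at `r = 1 / 2`. -/
lemma tiltVariance_le (hb : 0 < b) {N : ℝ} (hN : ∀ t, Real.log b < t → tiltVariance b t ≤ N)
    {t : ℝ} (ht : 0 < t) : tiltVariance b t ≤ N := by
  rcases lt_or_ge (Real.log b) t with h | h
  · exact hN t h
  have h1 : tiltVariance b (Real.log b) ≤ N := by
    refine le_of_tendsto (((continuous_tiltVariance hb).tendsto _).mono_left
      (nhdsWithin_le_nhds (s := Ioi (Real.log b)))) ?_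
    filter_upwards [self_mem_nhdsWithin] with u hu using hN u hu
  refine le_trans ?_ h1
  rw [tiltVariance, tiltVariance, prob_log_self hb]
  have h2 : prob b t * (1 - prob b t) ≤ 1 / 2 * (1 - 1 / 2) := by
    nlinarith [sq_nonneg (prob b t - 1 / 2)]
  have h3 : 0 ≤ prob b t * (1 - prob b t) :=
    mul_nonneg (prob_pos hb t).le (by linarith [prob_lt_one hb t])
  have h4 : t ^ 2 ≤ Real.log b ^ 2 := by gcongr
  exact mul_le_mul h4 h2 h3 (sq_nonneg _)

/-- Integrating `t ^ 2 * prob b t * (1 - prob b t) ≤ N` twice along the ray `a ↦ a t`. -/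
lemma gibbsDiv_tilt_le (hb : 0 < b) {N : ℝ} (hN : ∀ t, 0 < t → tiltVariance b t ≤ N) {t a : ℝ}
    (ht : 0 < t) (ha : 0 < a) : gibbsDiv b (prob b t) (a * t) ≤ N * (a - 1 - Real.log a) := by
  have hlin : ∀ a : ℝ, HasDerivAt (fun a => a * t) t a := fun a => by
    simpa using (hasDerivAt_id a).mul_const t
  have h := le_of_deriv_eq_zero_of_deriv2_nonneg (convex_Ioi 0) isOpen_Ioi
    (f := fun a => N * (a - 1 - Real.log a) - gibbsDiv b (prob b t) (a * t))
    (f' := fun a => N * (1 - a⁻¹) - (prob b t - prob b (a * t)) * t)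
    (f'' := fun a => N * (a ^ 2)⁻¹ - prob b (a * t) * (1 - prob b (a * t)) * t ^ 2)
    (fun a ha => by
      have h1 := (((hasDerivAt_id a).sub_const 1).sub
        (Real.hasDerivAt_log (ne_of_gt ha))).const_mul N
      have h2 := HasDerivAt.comp (h₂ := gibbsDiv b (prob b t)) (h := fun a => a * t) a
        (hasDerivAt_gibbsDiv hb (prob b t) (a * t)) (hlin a)
      exact h1.sub h2)
    (fun a ha => by
      have h1 := ((hasDerivAt_inv (ne_of_gt ha)).const_sub 1).const_mul N
      have h2 := HasDerivAt.comp (h₂ := prob b) (h := fun a => a * t) a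
        (hasDerivAt_prob hb (a * t)) (hlin a)
      exact (h1.sub ((h2.const_sub (prob b t)).mul_const t)).congr_deriv (by ring))
    (fun a (ha : 0 < a) => by
      have h1 := hN (a * t) (by positivity)
      rw [tiltVariance] at h1
      have h2 : prob b (a * t) * (1 - prob b (a * t)) * t ^ 2
          = (a * t) ^ 2 * (prob b (a * t) * (1 - prob b (a * t))) * (a ^ 2)⁻¹ := by
        field_simp
      rw [h2, ← sub_mul]
      exact mul_nonneg (by linarith) (by positivity))
    (mem_Ioi.2 one_pos) (by simp) (mem_Ioi.2 ha)
  simp only [sub_self, Real.log_one, mul_zero, one_mul, gibbsDiv_self hb] at h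
  linarith

/-- The lower bound on the minimal relative entropy. The multiplier `l = e ^ (x / N) - 1` is the
derivative of the bound at `x`. -/
theorem bound_le_minRelEntropy (hb : 0 < b) {N : ℝ} (hN0 : 0 < N)
    (hN : ∀ t, Real.log b < t → tiltVariance b t ≤ N) (x : ℝ) :
    ((N * (Real.exp (x / N) - 1 - x / N) : ℝ) : EReal) ≤ minRelEntropy b x := by
  refine le_minRelEntropy fun p hp hpx => ?_
  rcases square_cases hb hp with rfl | ⟨-, -, h⟩ | ⟨t, ht, hr, h⟩
  · rw [entropyDiff, sub_self] at hpx
    subst hpx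
    simp [binRelEntropy_zero_zero]
  · rw [h]
    exact le_top
  rw [h, EReal.coe_le_coe_iff]
  set y := x / N with hy
  have hxy : x = N * y := by rw [hy]; field_simp
  set l := Real.exp y - 1 with hl
  have hl1 : 1 + l = Real.exp y := by rw [hl]; ring
  have hl' : -1 < l := by linarith [Real.exp_pos y]
  have ht0 : 0 ≤ t := ht.2
  have h1 : -(Real.exp y * (N * (Real.exp (-y) - 1 + y))) ≤ reducedLagrangian b l t := by
    rw [reducedLagrangian, hl1, neg_le_neg_iff]
    refine mul_le_mul_of_nonneg_left ?_ (Real.exp_pos y).le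
    rcases ht0.eq_or_lt with rfl | htpos
    · rw [zero_div, gibbsDiv_self hb]
      exact mul_nonneg hN0.le (by linarith [Real.add_one_le_exp (-y)])
    · have h2 := gibbsDiv_tilt_le hb (fun t ht => tiltVariance_le hb hN ht) htpos
        (Real.exp_pos (-y))
      rw [Real.log_exp, sub_neg_eq_add, Real.exp_neg, inv_mul_eq_div] at h2
      rw [Real.exp_neg]
      exact h2
  have h2 : reducedLagrangian b l t ≤ lagrangian b l p.1 t := by
    rw [lagrangian_eq_reduced hb hl']
    have := mul_nonneg (by linarith : 0 ≤ 1 + l) (gibbsDiv_nonneg hb (t / (1 + l)) ht.1.1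
      (ht.1.2.trans (uniform_lt_one hb).le))
    linarith
  have h3 : lagrangian b l p.1 t = gibbsDiv b p.1 t - l * x := by
    rw [lagrangian, ← hpx, entropyDiff, hr]
  have h4 : Real.exp y * (N * (Real.exp (-y) - 1 + y)) = N * (1 - Real.exp y + y * Real.exp y) := by
    rw [Real.exp_neg]
    field_simp
  have h5 : l * x = N * (y * Real.exp y - y) := by
    rw [hl, hxy]
    ring
  linarith

lemma cubic_bound_le {N : ℝ} (hN : 0 < N) (x : ℝ) :
    x ^ 2 / (2 * N) + x ^ 3 / (6 * N ^ 2) ≤ N * (Real.exp (x / N) - 1 - x / N) := by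
  have h := mul_le_mul_of_nonneg_left (cubic_le_exp (x / N)) hN.le
  have e : N * (1 + x / N + (x / N) ^ 2 / 2 + (x / N) ^ 3 / 6)
      = N * (1 + x / N) + (x ^ 2 / (2 * N) + x ^ 3 / (6 * N ^ 2)) := by
    field_simp
    ring
  linarith

/-! ### The maximal variance of the surprisal -/

lemma hasDerivAt_tiltVariance (hb : 0 < b) (t : ℝ) :
    HasDerivAt (tiltVariance b)
      (t * (prob b t * (1 - prob b t)) * (2 - t * (1 - 2 * prob b t))) t := by
  have hp := hasDerivAt_prob hb t
  have := (hasDerivAt_pow 2 t).mul (hp.mul (hp.const_sub 1))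
  exact this.congr_deriv (by simp only [Pi.mul_apply]; push_cast; ring)

lemma tiltVariance_le_exp (hb : 0 < b) (t : ℝ) :
    tiltVariance b t ≤ b * (t ^ 2 * Real.exp (-t)) := by
  have h1 : prob b t ≤ b * Real.exp (-t) := by
    rw [prob, Real.exp_neg, ← div_eq_mul_inv]
    have := Real.exp_pos t
    gcongr
    linarith
  have h2 : prob b t * (1 - prob b t) ≤ b * Real.exp (-t) := by
    nlinarith [prob_pos hb t]
  rw [tiltVariance]
  calc t ^ 2 * (prob b t * (1 - prob b t)) ≤ t ^ 2 * (b * Real.exp (-t)) := by gcongr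
    _ = b * (t ^ 2 * Real.exp (-t)) := by ring

lemma tiltVariance_pos (hb : 0 < b) {t : ℝ} (ht : 0 < t) : 0 < tiltVariance b t := by
  have h1 := prob_pos hb t
  have h2 : 0 < 1 - prob b t := by linarith [prob_lt_one hb t]
  unfold tiltVariance
  positivity

/-- The variance is not maximal at `r = 1 / 2`: it has a positive derivative there, or vanishes. -/
lemma exists_tiltVariance_gt (hb : 1 ≤ b) :
    ∃ t, Real.log b < t ∧ tiltVariance b (Real.log b) < tiltVariance b t := by
  have hb0 : 0 < b := by linarith
  rcases (Real.log_nonneg hb).eq_or_lt with h | h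
  · refine ⟨1, by rw [← h]; exact one_pos, ?_⟩
    have h1 := tiltVariance_pos hb0 one_pos
    rw [← h]
    simpa [tiltVariance] using h1
  · have h1 := hasDerivAt_tiltVariance hb0 (Real.log b)
    rw [prob_log_self hb0] at h1
    have h2 := (hasDerivAt_iff_tendsto_slope.1 h1).eventually (lt_mem_nhds (a := 0) (by
      norm_num
      exact h))
    have h3 : ∀ᶠ t in 𝓝[>] (Real.log b), 0 < slope (tiltVariance b) (Real.log b) t :=
      h2.filter_mono (nhdsWithin_mono _ (fun t (ht : Real.log b < t) => ht.ne'))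
    obtain ⟨t, ht, htb⟩ := (h3.and self_mem_nhdsWithin).exists
    refine ⟨t, htb, ?_⟩
    rw [slope_def_field] at ht
    exact sub_pos.1 ((div_pos_iff_of_pos_right (sub_pos.2 htb)).1 ht)

lemma exists_isGreatest_tiltVariance (hb : 1 ≤ b) :
    ∃ t, Real.log b < t ∧ ∀ u, Real.log b < u → tiltVariance b u ≤ tiltVariance b t := by
  have hb0 : 0 < b := by linarith
  obtain ⟨t₀, ht₀, hgt⟩ := exists_tiltVariance_gt hb
  have h0 : 0 < tiltVariance b t₀ := tiltVariance_pos hb0 ((Real.log_nonneg hb).trans_lt ht₀)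
  have htend : Tendsto (fun t => b * (t ^ 2 * Real.exp (-t))) atTop (𝓝 0) := by
    simpa using (Real.tendsto_pow_mul_exp_neg_atTop_nhds_zero 2).const_mul b
  obtain ⟨T, hT⟩ := eventually_atTop.1 (htend.eventually (gt_mem_nhds h0))
  obtain ⟨t, ht, hmax⟩ := isCompact_Icc.exists_isMaxOn
    (⟨t₀, ht₀.le, le_max_left t₀ T⟩ : (Icc (Real.log b) (max t₀ T)).Nonempty)
    (continuous_tiltVariance hb0).continuousOn
  have hge : tiltVariance b t₀ ≤ tiltVariance b t := hmax ⟨ht₀.le, le_max_left t₀ T⟩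
  refine ⟨t, lt_of_le_of_ne ht.1 fun h => ?_, fun u hu => ?_⟩
  · rw [← h] at hge
    linarith
  · rcases le_or_gt u (max t₀ T) with h | h
    · exact hmax ⟨hu.le, h⟩
    · have := hT u ((le_max_right t₀ T).trans h.le)
      linarith [tiltVariance_le_exp hb0 u]

/-- With `v = (t - log b) / 2`, the variance is `(log b + 2 v) ^ 2 / (4 cosh ^ 2 v)`. -/
lemma four_mul_tiltVariance (hb : 0 < b) (t : ℝ) :
    4 * (tiltVariance b t * Real.cosh ((t - Real.log b) / 2) ^ 2) = t ^ 2 := by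
  set v := (t - Real.log b) / 2 with hv
  have ht : Real.exp t = b * Real.exp v ^ 2 := by
    have h : t = Real.log b + (2 : ℕ) * v := by rw [hv]; push_cast; ring
    rw [h, Real.exp_add, Real.exp_log hb, Real.exp_nat_mul]
  rw [tiltVariance, one_sub_prob hb, prob, ht, Real.cosh_eq, Real.exp_neg]
  have := Real.exp_pos v
  field_simp
  ring

/-- Cauchy–Schwarz for `log b * 1 + 2 * v`, and `1 + v ^ 2 < 1 + sinh ^ 2 v = cosh ^ 2 v`. -/
lemma tiltVariance_lt (hb : 0 < b) {t : ℝ} (ht : Real.log b < t) :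
    tiltVariance b t < 1 / 4 * Real.log b ^ 2 + 1 := by
  have h := four_mul_tiltVariance hb t
  set v := (t - Real.log b) / 2 with hv
  have hv0 : 0 < v := by rw [hv]; linarith
  have htv : t = Real.log b * 1 + 2 * v := by rw [hv]; ring
  have h1 : v < Real.sinh v := Real.self_lt_sinh_iff.2 hv0
  have h2 : 1 + v ^ 2 < Real.cosh v ^ 2 := by
    rw [Real.cosh_sq]
    nlinarith
  have h3 : t ^ 2 ≤ (Real.log b ^ 2 + 4) * (1 + v ^ 2) := by
    rw [htv]
    nlinarith [sq_nonneg (Real.log b * v - 2)]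
  have h4 : (Real.log b ^ 2 + 4) * (1 + v ^ 2) < (Real.log b ^ 2 + 4) * Real.cosh v ^ 2 :=
    mul_lt_mul_of_pos_left h2 (by positivity)
  have h5 : 0 < Real.cosh v ^ 2 := by positivity
  nlinarith

/-- For `b = 1` the maximal variance is about `0.4392`. The bound `v ≤ 0.6708 cosh v` follows from
the tangent of the logarithm at `10 / 3 ≈ e ^ 1.2`, close to the maximizer of `v / cosh v`. -/
lemma tiltVariance_one_le {t : ℝ} (ht : 0 < t) : tiltVariance 1 t ≤ 0.45 := by
  have h := four_mul_tiltVariance one_pos t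
  rw [Real.log_one, sub_zero] at h
  have hlog : Real.log (10 / 3) ≤ 1.2131 := by
    have h1 : Real.log ((10 / 3) ^ 4) ≤ Real.log (2 ^ 7) :=
      Real.log_le_log (by norm_num) (by norm_num)
    rw [Real.log_pow, Real.log_pow] at h1
    push_cast at h1
    linarith [Real.log_two_lt_d9]
  have hE := Real.exp_pos (t / 2)
  have h1 : t / 2 ≤ 0.2131 + 0.3 * Real.exp (t / 2) := by
    have h2 := Real.log_le_sub_one_of_pos (x := Real.exp (t / 2) / (10 / 3)) (by positivity)
    rw [Real.log_div hE.ne' (by norm_num), Real.log_exp] at h2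
    linarith
  have h2 : t / 2 ≤ 0.6708 * Real.cosh (t / 2) := by
    rw [Real.cosh_eq, Real.exp_neg]
    set T := Real.exp (t / 2)
    have h3 : 0.6708 * ((T + T⁻¹) / 2) - (0.2131 + 0.3 * T)
        = (0.0354 * T ^ 2 - 0.2131 * T + 0.3354) / T := by
      field_simp
      ring
    have h4 : 0 ≤ 0.0354 * T ^ 2 - 0.2131 * T + 0.3354 := by
      nlinarith [sq_nonneg (T - 3.01)]
    have h5 := div_nonneg h4 hE.le
    linarith
  have h3 : (t / 2) ^ 2 ≤ (0.6708 * Real.cosh (t / 2)) ^ 2 := by gcongr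
  have h4 : 0 < Real.cosh (t / 2) ^ 2 := by positivity
  nlinarith

lemma log_two_sq_gt : 0.4803 < Real.log 2 ^ 2 := by
  nlinarith [Real.log_two_gt_d9]

lemma quarter_log_sq_lt {d : ℕ} (hd : 3 ≤ d) :
    1 / 4 * Real.log ((d : ℝ) - 1) ^ 2 + 1 < Real.log d ^ 2 := by
  rcases hd.eq_or_lt with rfl | hd
  · have h1 : ((3 : ℕ) : ℝ) - 1 = 2 := by norm_num
    rw [h1]
    push_cast
    have := Real.log_three_gt_d9
    have := Real.log_two_lt_d9
    nlinarith [Real.log_two_gt_d9]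
  · have hd' : (4 : ℝ) ≤ d := by exact_mod_cast hd
    have h1 : Real.log ((d : ℝ) - 1) ≤ Real.log d := Real.log_le_log (by linarith) (by linarith)
    have h2 : 0 ≤ Real.log ((d : ℝ) - 1) := Real.log_nonneg (by linarith)
    have h3 : Real.log (2 ^ 2) ≤ Real.log d := Real.log_le_log (by norm_num) (by linarith)
    rw [Real.log_pow] at h3
    push_cast at h3
    nlinarith [Real.log_two_gt_d9]

/-! ### The quadratic lower bound -/

lemma quadratic_le_bound_of_one_le {L x : ℝ} (hL : 1 ≤ L) (hx : -L ≤ x) :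
    x ^ 2 / (3 * L ^ 2) ≤ L ^ 2 * (Real.exp (x / L ^ 2) - 1 - x / L ^ 2) := by
  have hL0 : 0 < L := by linarith
  refine le_trans ?_ (cubic_bound_le (by positivity) x)
  have h : x ^ 2 / (2 * L ^ 2) + x ^ 3 / (6 * (L ^ 2) ^ 2) - x ^ 2 / (3 * L ^ 2)
      = x ^ 2 * (L ^ 2 + x) / (6 * (L ^ 2) ^ 2) := by
    field_simp
    ring
  have : 0 ≤ L ^ 2 + x := by nlinarith
  have : 0 ≤ x ^ 2 * (L ^ 2 + x) / (6 * (L ^ 2) ^ 2) := by positivity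
  linarith

/-- The case `d = 2`, where `log d < 1` and `N = (log d) ^ 2` is too large. For `N = 0.45` and `x < 0`
the cubic bound is applied to `e ^ (x / (2 N))` and squared. -/
lemma quadratic_le_bound_two {x : ℝ} (hx : -Real.log 2 ≤ x) :
    x ^ 2 / (3 * Real.log 2 ^ 2) ≤ 0.45 * (Real.exp (x / 0.45) - 1 - x / 0.45) := by
  have hsq := log_two_sq_gt
  have h1 : x ^ 2 / (3 * Real.log 2 ^ 2) ≤ x ^ 2 / (3 * 0.4803) := by gcongr
  refine h1.trans ?_
  rcases le_or_gt 0 x with h0 | h0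
  · refine le_trans ?_ (cubic_bound_le (by norm_num) x)
    have : 0 ≤ x ^ 3 / (6 * 0.45 ^ 2) := by positivity
    have : 0 ≤ x ^ 2 := sq_nonneg x
    norm_num at *
    linarith
  · set w := -x / 0.9 with hw
    have hxw : x = -0.9 * w := by rw [hw]; ring
    have hw0 : 0 ≤ w := by rw [hw]; apply div_nonneg <;> linarith
    have hw1 : w ≤ 0.7703 := by
      rw [hw, div_le_iff₀ (by norm_num)]
      linarith [Real.log_two_lt_d9]
    have hexp : Real.exp (x / 0.45) = Real.exp (-w) ^ 2 := by
      rw [← Real.exp_nat_mul, hxw]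
      congr 1
      push_cast
      ring
    have hc := cubic_le_exp (-w)
    have hpos : 0 ≤ 1 + -w + (-w) ^ 2 / 2 + (-w) ^ 3 / 6 := by
      nlinarith [mul_nonneg hw0 hw0, mul_nonneg hw0 (sub_nonneg.2 hw1),
        mul_nonneg (mul_nonneg hw0 hw0) (sub_nonneg.2 hw1)]
    have hsq2 : (1 + -w + (-w) ^ 2 / 2 + (-w) ^ 3 / 6) ^ 2 ≤ Real.exp (-w) ^ 2 := by gcongr
    rw [hexp, hxw]
    have hpoly : 0 ≤ 2 - 4 / 3 * w + 7 / 12 * w ^ 2 - w ^ 3 / 6 + w ^ 4 / 36 - 1.2493 := by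
      nlinarith [mul_nonneg hw0 (sub_nonneg.2 hw1), sq_nonneg (w - 0.77),
        mul_nonneg hw0 (sq_nonneg (w - 0.77)), sq_nonneg (w * (w - 0.77))]
    have hfin := mul_nonneg (sq_nonneg w) hpoly
    norm_num at *
    nlinarith

/-! ### The theorem in terms of `d` -/

lemma feasiblePairs_eq (x : ℝ) (d : ℕ) :
    feasiblePairs x d = {p ∈ square ((d : ℝ) - 1) | entropyDiff ((d : ℝ) - 1) p = x} := by
  ext p
  simp only [feasiblePairs, square, entropyDiff, entropy, mem_ofPred_eq, mem_prod, sub_add_cancel,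
    and_assoc]
  refine and_congr_right fun _ => and_congr_right fun _ => ?_
  rw [← sub_eq_zero, ← sub_eq_zero (b := x)]
  ring_nf

lemma boundM_eq (x : ℝ) (d : ℕ) : boundM x d = minRelEntropy ((d : ℝ) - 1) x := by
  rw [boundM, feasiblePairs_eq, minRelEntropy]

lemma varSurprisal_prob {d : ℕ} (hd : 0 < (d : ℝ) - 1) (t : ℝ) :
    varSurprisal d (prob ((d : ℝ) - 1) t) = tiltVariance ((d : ℝ) - 1) t := by
  have h : Real.log ((1 - prob ((d : ℝ) - 1) t) / prob ((d : ℝ) - 1) t * ((d : ℝ) - 1)) = t :=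
    (prob_strictAnti hd).injective (prob_log hd (prob_pos hd t) (prob_lt_one hd t))
  rw [varSurprisal, h, tiltVariance]
  ring

lemma varSurprisal_image {d : ℕ} (hd : 0 < (d : ℝ) - 1) :
    varSurprisal d '' Ioo 0 (1 / 2) =
      tiltVariance ((d : ℝ) - 1) '' Ioi (Real.log ((d : ℝ) - 1)) := by
  have himage : Ioo (0 : ℝ) (1 / 2) = prob ((d : ℝ) - 1) '' Ioi (Real.log ((d : ℝ) - 1)) := by
    ext r
    constructor
    · rintro ⟨h0, h1⟩
      have hr := prob_log hd h0 (h1.trans (by norm_num))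
      refine ⟨_, ?_, hr⟩
      rw [mem_Ioi, ← (prob_strictAnti hd).lt_iff_gt, hr, prob_log_self hd]
      exact h1
    · rintro ⟨t, ht, rfl⟩
      exact ⟨prob_pos hd t, prob_log_self hd ▸ prob_strictAnti hd ht⟩
  rw [himage, image_image]
  exact image_congr fun t _ => varSurprisal_prob hd t

lemma isGreatest_boundN {d : ℕ} (hd : 2 ≤ d) :
    IsGreatest (tiltVariance ((d : ℝ) - 1) '' Ioi (Real.log ((d : ℝ) - 1))) (boundN d) := by
  have hd' : (2 : ℝ) ≤ d := by exact_mod_cast hd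
  obtain ⟨t, ht, hmax⟩ := exists_isGreatest_tiltVariance (b := (d : ℝ) - 1) (by linarith)
  have h : IsGreatest (tiltVariance ((d : ℝ) - 1) '' Ioi (Real.log ((d : ℝ) - 1)))
      (tiltVariance ((d : ℝ) - 1) t) :=
    ⟨⟨t, ht, rfl⟩, by rintro _ ⟨u, hu, rfl⟩; exact hmax u hu⟩
  rw [boundN, varSurprisal_image (by linarith), h.csSup_eq]
  exact h

lemma boundN_pos {d : ℕ} (hd : 2 ≤ d) : 0 < boundN d := by
  have hd' : (2 : ℝ) ≤ d := by exact_mod_cast hd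
  obtain ⟨t, ht, h⟩ := (isGreatest_boundN hd).1
  rw [← h]
  exact tiltVariance_pos (by linarith) ((Real.log_nonneg (by linarith)).trans_lt ht)

lemma boundN_lt {d : ℕ} (hd : 2 ≤ d) : boundN d < 1 / 4 * Real.log ((d : ℝ) - 1) ^ 2 + 1 := by
  have hd' : (2 : ℝ) ≤ d := by exact_mod_cast hd
  obtain ⟨t, ht, h⟩ := (isGreatest_boundN hd).1
  rw [← h]
  exact tiltVariance_lt (by linarith) ht

lemma boundN_two_le : boundN 2 ≤ 0.45 := by
  obtain ⟨t, ht, h⟩ := (isGreatest_boundN le_rfl).1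
  have e : ((2 : ℕ) : ℝ) - 1 = 1 := by norm_num
  rw [e] at ht h
  rw [← h]
  exact tiltVariance_one_le (by rwa [mem_Ioi, Real.log_one] at ht)

lemma boundN_lt_log_sq {d : ℕ} (hd : 2 ≤ d) : boundN d < Real.log d ^ 2 := by
  rcases hd.eq_or_lt with rfl | hd'
  · have := boundN_two_le
    have := log_two_sq_gt
    push_cast
    linarith
  · exact (boundN_lt hd).trans (quarter_log_sq_lt hd')

lemma bound_le_boundM {d : ℕ} (hd : 2 ≤ d) {N : ℝ} (hN : boundN d ≤ N) (x : ℝ) :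
    ((N * (Real.exp (x / N) - 1 - x / N) : ℝ) : EReal) ≤ boundM x d := by
  have hd' : (2 : ℝ) ≤ d := by exact_mod_cast hd
  rw [boundM_eq]
  exact bound_le_minRelEntropy (by linarith) ((boundN_pos hd).trans_le hN)
    (fun t ht => ((isGreatest_boundN hd).2 ⟨t, ht, rfl⟩).trans hN) x

lemma quadratic_le_boundM {d : ℕ} (hd : 2 ≤ d) (x : ℝ) :
    ((x ^ 2 / (3 * Real.log d ^ 2) : ℝ) : EReal) ≤ boundM x d := by
  by_cases hx : x ∈ Icc (-Real.log d) (Real.log d)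
  · rcases hd.eq_or_lt with rfl | hd'
    · refine le_trans ?_ (bound_le_boundM le_rfl boundN_two_le x)
      exact EReal.coe_le_coe_iff.2 (quadratic_le_bound_two hx.1)
    · refine le_trans ?_ (bound_le_boundM hd (boundN_lt_log_sq hd).le x)
      have hd3 : (3 : ℝ) ≤ d := by exact_mod_cast hd'
      have h3 : Real.log 3 ≤ Real.log d := Real.log_le_log (by norm_num) hd3
      exact EReal.coe_le_coe_iff.2
        (quadratic_le_bound_of_one_le (by linarith [Real.log_three_gt_d9]) hx.1)
  · have hd' : (2 : ℝ) ≤ d := by exact_mod_cast hd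
    rw [boundM_eq, minRelEntropy_eq_top (by linarith) (by rwa [sub_add_cancel])]
    exact le_top

end EntropyDifference

open EntropyDifference in
theorem theorem2 (d : ℕ) (hd : 2 ≤ d) :
    -- both optimizations are attained, i.e. `M(Δ, d)` is a minimum and `N(d)` is a maximum
    (∀ Δ ∈ Set.Icc (-Real.log d) (Real.log d),
      IsLeast ((fun p : ℝ × ℝ => binRelEntropy p.1 p.2) '' feasiblePairs Δ d) (boundM Δ d)) ∧
    IsGreatest (varSurprisal d '' Set.Ioo (0 : ℝ) (1 / 2)) (boundN d) ∧
    -- non-negativity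
    (∀ Δ ∈ Set.Icc (-Real.log d) (Real.log d), 0 ≤ boundM Δ d) ∧
    -- continuity, as a function into the extended reals
    ContinuousOn (fun Δ : ℝ => boundM Δ d) (Set.Icc (-Real.log d) (Real.log d)) ∧
    -- strict convexity, as a function into the extended reals
    (∀ x ∈ Set.Icc (-Real.log d) (Real.log d), ∀ y ∈ Set.Icc (-Real.log d) (Real.log d), x ≠ y →
      ∀ a b : ℝ, 0 < a → 0 < b → a + b = 1 →
        boundM (a * x + b * y) d < (a : EReal) * boundM x d + (b : EReal) * boundM y d) ∧
    -- continuous differentiability in the interior, where `M(Δ, d)` is finite (see below)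
    ContDiffOn ℝ 1 (fun Δ : ℝ => (boundM Δ d).toReal) (Set.Ioo (-Real.log d) (Real.log d)) ∧
    -- values
    boundM 0 d = 0 ∧
    boundM (-Real.log d) d = ((Real.log d : ℝ) : EReal) ∧
    boundM (Real.log d) d = ⊤ ∧
    (∀ Δ ∈ Set.Ico (-Real.log d) (Real.log d), boundM Δ d < ⊤) ∧
    -- lower bounds
    (∀ N : ℝ, boundN d ≤ N → ∀ Δ : ℝ,
      ((N * (Real.exp (Δ / N) - 1 - Δ / N) : ℝ) : EReal) ≤ boundM Δ d ∧
      Δ ^ 2 / (2 * N) + Δ ^ 3 / (6 * N ^ 2) ≤ N * (Real.exp (Δ / N) - 1 - Δ / N)) ∧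
    (∀ Δ : ℝ, ((Δ ^ 2 / (3 * Real.log d ^ 2) : ℝ) : EReal) ≤ boundM Δ d) ∧
    -- admissible choices of `N`
    boundN d < 1 / 4 * Real.log ((d : ℝ) - 1) ^ 2 + 1 ∧
    boundN d < Real.log d ^ 2 := by
  have hd' : (2 : ℝ) ≤ d := by exact_mod_cast hd
  have hb : 1 ≤ (d : ℝ) - 1 := by linarith
  have hb0 : 0 < (d : ℝ) - 1 := by linarith
  have hlog : Real.log d = Real.log ((d : ℝ) - 1 + 1) := by rw [sub_add_cancel]
  refine ⟨?_, ?_, ?_, ?_, ?_, ?_, ?_, ?_, ?_, ?_,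
    fun N hN x => ⟨bound_le_boundM hd hN x, cubic_bound_le ((boundN_pos hd).trans_le hN) x⟩,
    quadratic_le_boundM hd, boundN_lt hd, boundN_lt_log_sq hd⟩
  · intro x hx
    rw [boundM_eq, feasiblePairs_eq]
    exact isLeast_minRelEntropy hb (hlog ▸ hx)
  · rw [varSurprisal_image hb0]
    exact isGreatest_boundN hd
  all_goals simp only [boundM_eq, hlog]
  · exact fun x _ => minRelEntropy_nonneg hb0 x
  · exact continuousOn_minRelEntropy hb
  · exact fun x hx y hy hxy u v hu hv huv => minRelEntropy_strictConvex hb hx hy hxy hu hv huv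
  · exact contDiffOn_minRelEntropy hb
  · exact minRelEntropy_zero hb
  · exact minRelEntropy_left hb
  · exact minRelEntropy_right hb
  · exact fun x hx => minRelEntropy_lt_top hb hx
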